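/- Let $F=F(A)$ be the free group on a finite alphabet $A$, and let $R_1,R_2\subset F$ be non-empty finite symmetrized sets (all elements are cyclically reduced, and all cyclic permutations of $r^{\pm1}$ belong to $R_i$ for each $r\in R_i$), with normal closures $N_1,N_2$ in $F$. Put $G_i=F/N_i$ $(i=1,2)$ and $G=F/N_1N_2$. A picture over $\langle A\mid R\rangle$ on the oriented torus is a finite graph drawn on the torus (possibly with additional closed edges without end points) whose oriented edges are labelled by words over $A^{\pm1}$, such that for every vertex the word read along a small circle around it (each crossed edge contributing its label to the power $\pm1$ given by the local intersection index) is, letter by letter, the reduced word of an element of $R$. A dipole is a pair of distinct vertices joined by an edge $E$ such that the word read in the positive direction around the first vertex and the word read in the negative direction around the second one, from points next to $E$ on the same side of $E$, are equal in $F$. The presentation $\langle A\mid R\rangle$ is atorical if every connected picture over it on the torus with at least one vertex contains a dipole. Suppose that the presentation $\langle A\mid R_1\cup R_2\rangle$ of $G$ is atorical. Let $u,v,\alpha,\beta,\omega\in F$, $\nu_1\in N_1$, $\nu_2\in N_2$ and $k,l\in\mathbb Z$ be such that $$u=\alpha(\omega^{k}\nu_1\omega^{-l}\nu_2\omega^{l})\alpha^{-1},\qquad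 v=\beta(\omega^{k}\nu_1\nu_2)\beta^{-1}\qquad\text{in } F/(N_1\cap N_2).$$ Put $\tilde v=\beta^{-1}v\beta$ and assume that $\tilde v\neq1$ in $G_1$ and $\tilde v\ne1$ in $G_2$. For $i=1,2$ let $\mathrm{Roots}_{G_i}(\tilde v)$ be the set of all $c\in F$ such that $\tilde v=c^{s}$ in $G_i$ for some $s\in\mathbb Z$. For $c\in \mathrm{Roots}_{G_1}(\tilde v)$ let $s(c)$ be the integer $s$ of least absolute value with $\tilde v=c^s$ in $G_1$, and for $d\in \mathrm{Roots}_{G_2}(\tilde v)$ let $t(d)$ be the integer $t$ of least absolute value with $\tilde v=d^t$ in $G_2$ (if two opposite integers qualify, the positive one is taken). Then $u$ and $v$ are conjugate in $F/(N_1\cap N_2)$ if and only if there exist $c\in \mathrm{Roots}_{G_1}(\tilde v)$, $d\in \mathrm{Roots}_{G_2}(\tilde v)$ and $\bar s,\bar t\in\mathbb Z$ with $0\le\bar s<s(c)$ and $0\le\bar t<t(d)$ such that $d^{-\bar t}c^{-\bar s}\omega^{l}$ belongs to the cyclic subgroup $\langle\tilde v\rangle$ of $G$. -/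

import Mathlib

namespace AtoricalConj

/-- A set `R` of elements of the free group `F(A)` is symmetrized: the reduced word of each
element of `R` is cyclically reduced, and all cyclic permutations of it and of its inverse
represent elements of `R`. -/
def Symmetrized {A : Type*} (R : Set (FreeGroup A)) : Prop :=
  ∀ L : List (A × Bool), FreeGroup.IsReduced L → FreeGroup.mk L ∈ R →
    FreeGroup.IsCyclicallyReduced L ∧
      ∀ L' : List (A × Bool), (L' ~r L ∨ L' ~r FreeGroup.invRev L) → FreeGroup.mk L' ∈ R

/-- A finite graph drawn on an oriented closed surface, with edges labelled by words of `F(A)`,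
given by its rotation system.

`D` is the set of edge ends ("darts"). `flip` exchanges the two ends of an edge. `next` sends an
edge end to the following one in the positive (counterclockwise) order around its vertex, so the
vertices are the cycles of `next`. `label d` is the contribution of the edge of `d` to the word
read along a small positively oriented circle around the vertex of `d`; the circles around the
two ends of an edge cross it in opposite directions, so the contributions are inverse words.
Words are not required to be reduced or non-empty. (A single isolated vertex, with the empty
word as its label, is represented by one vertex with a loop labelled by the empty word.) -/
structure LabelledMap (A : Type*) (D : Type) where
  next : Equiv.Perm D
  flip : Equiv.Perm D
  flip_flip : ∀ d, flip (flip d) = d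
  flip_ne : ∀ d, flip d ≠ d
  label : D → List (A × Bool)
  label_flip : ∀ d, label (flip d) = FreeGroup.invRev (label d)

namespace LabelledMap

variable {A : Type*} {D : Type}

/-- The word read in the positive direction along a small circle around the vertex of `d`,
starting at a point of the circle immediately before `d`. -/
noncomputable def vertexWord (P : LabelledMap A D) (d : D) : List (A × Bool) :=
  (List.range (Function.minimalPeriod P.next d)).flatMap fun i => P.label ((P.next ^ i) d)

/-- The labels of all vertices belong to `R`: they are, letter by letter, the reduced words of
elements of `R`. -/
def IsOver (P : LabelledMap A D) (R : Set (FreeGroup A)) : Prop :=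
  ∀ d, FreeGroup.IsReduced (P.vertexWord d) ∧ FreeGroup.mk (P.vertexWord d) ∈ R

/-- The graph is connected and has at least one vertex. -/
def Connected (P : LabelledMap A D) : Prop :=
  Nonempty D ∧
    ∀ d d' : D, ∃ g ∈ Subgroup.closure ({P.next, P.flip} : Set (Equiv.Perm D)), g d = d'

/-- The number of cycles of a permutation, fixed points included. -/
noncomputable def numCycles (f : Equiv.Perm D) : ℕ :=
  Nat.card (Quotient (Equiv.Perm.SameCycle.setoid f))

/-- `V - E + F` for the rotation system; the boundary walks of the faces are the cycles of
`next * flip`. -/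
noncomputable def eulerChar (P : LabelledMap A D) : ℤ :=
  (numCycles P.next : ℤ) - (Nat.card D / 2 : ℕ) + (numCycles (P.next * P.flip) : ℤ)

/-- A connected graph with a rotation system can be drawn on the oriented torus, respecting the
rotation system, exactly when the genus `g` of the system is `0` or `1`, that is, when
`2 - 2 * g ≥ 0`. (For `g = 1` all faces are discs; for `g = 0` the graph lies in a disc or in
an annulus of the torus.) -/
def OnTorus (P : LabelledMap A D) : Prop :=
  0 ≤ P.eulerChar

/-- A dipole: an edge joining two distinct vertices such that the label of one vertex, read in
the positive direction from a point beside the edge, and the label of the other vertex, read in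
the negative direction from the point on the same side of the edge, are equal in the free group.
Here the side chosen is the one just before `d`, which is the side just after `flip d`. -/
def HasDipole (P : LabelledMap A D) : Prop :=
  ∃ d : D, ¬ P.next.SameCycle d (P.flip d) ∧
    FreeGroup.mk (P.vertexWord d) = (FreeGroup.mk (P.vertexWord (P.next (P.flip d))))⁻¹

end LabelledMap

/-- The presentation `⟨A | R⟩` is atorical: every connected picture over it on the torus with at
least one vertex contains a dipole. (Such a picture has no edges without end points.) -/
def Atorical {A : Type*} (R : Set (FreeGroup A)) : Prop :=
  ∀ (D : Type) [Finite D] (P : LabelledMap A D),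
    P.Connected → P.OnTorus → P.IsOver R → P.HasDipole

/-- `c ∈ Roots_{F/N}(w)`: the element `w` is a power of `c` in `F/N`. -/
def Roots {F : Type*} [Group F] (N : Subgroup F) [N.Normal] (w : F) : Set F :=
  {c | ∃ s : ℤ, (w : F ⧸ N) = (c : F ⧸ N) ^ s}

/-- `s = s(c)`: an integer of least absolute value with `w = c ^ s` in `F/N`. (It can fail to be
unique only when both `s` and `-s` qualify.) -/
def IsRootExponent {F : Type*} [Group F] (N : Subgroup F) [N.Normal] (w c : F) (s : ℤ) : Prop :=
  (w : F ⧸ N) = (c : F ⧸ N) ^ s ∧ ∀ s' : ℤ, (w : F ⧸ N) = (c : F ⧸ N) ^ s' → |s| ≤ |s'|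

end AtoricalConj

/-!
Conjugacy of `u` and `v` modulo `N₁ ∩ N₂` is conjugacy modulo `N₁` and modulo `N₂` by the same
element. Modulo `N₁` the element `u` is conjugate to `v'` by `ω ^ (-l)` (up to `α`), and modulo
`N₂` it is `v'` itself. Hence `u` and `v` are conjugate if and only if some `h` is such that
`h * ω ^ (-l)` commutes with `v'` modulo `N₁` and `h` commutes with `v'` modulo `N₂`
(`isConj_iff_exists_commute`). As `F / (N₁ ∩ N₂)` is the fibre product of `G₁` and `G₂` over `G`
(`exists_common_lift`), this says that `ω ^ l` is, in `G`, a product of images of elements of the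
two centralizers. Roots of `v'` lie in the centralizers; that every element of the centralizer is
of the form `c ^ s' * v' ^ q` for a root `c` follows (`exists_isRootExponent`) from the main point:
commuting elements of the group of an atorical presentation are powers of a common element
(`exists_zpow_of_commute`). Sub-presentations of an atorical presentation are atorical.

To prove it, write the relation `[x, y] ∈ N` as a graph on the torus: one vertex with two loops
labelled `x` and `y`, to which pendant edges are attached for the relators that occur. All vertices
are then labelled, up to conjugacy, by relators or trivially. Such a graph is a rotation system,
given by a vertex permutation `σ` and an edge involution `τ` of a finite set of darts, and its
holonomy is described by gauges: functions `p` on the faces with values in `F / N`, which change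
the label `λ d` of a dart into `p d * λ d * (p (σ d))⁻¹` (`gauged`). It is shown that, for a map of
genus at most one, all labels are powers of one element in a suitable gauge
(`gaugeCyclic_of_vertexCond`). For the initial map, which has only one face, this is the assertion
on `x` and `y`.

All moves of the proof have the form `σ ↦ swap x y * σ`, for which the change of the genus is found
by counting cycles (`genus2_swap_le`), and the change of the holonomy by comparing the gauge at `x`
and `y`. Edges are first replaced by parallel edges labelled by letters. Then cancelling labels
around vertices are removed, by cutting vertices in two and contracting edges. If cutting a vertex
cuts a handle, a map of genus zero remains; maps of genus zero are shown at the same time to be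
flat, so that the holonomy before the cut is generated by that of a single closed curve
(`HolonomyIn.of_split_bot`). When nothing cancels any more, conjugate cyclically reduced words
being cyclic permutations of each other (`isRotated_of_conj`), a component with nontrivial labels
is a picture in the sense of atoricity. So it contains a dipole (`exists_dipole`), whose edge is
contracted: this lowers the number of edges with nontrivial label, leaves a trivial word around the
new vertex and does not change the holonomy (`contract`, `cyclicHolonomy_of_letters`).
-/

namespace AtoricalConj

open Equiv

/-! ### Cycles of a permutation as lists -/

/-- `x :: l` lists the cycle of `x` under the permutation `f`, in order and without repetition
(a fixed point has the cycle `[x]`). -/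
def IsOrb {D : Type*} (f : Perm D) (x : D) (l : List D) : Prop :=
  List.IsChain (fun a b => f a = b) (x :: l ++ [x]) ∧ (x :: l).Nodup

section Orb

variable {D : Type*} {f : Perm D} {x y z : D} {l m : List D}

theorem map_range_eq_cons (f : Perm D) (x : D) (n : ℕ) :
    (List.range (n + 1)).map (fun i => (f ^ i) x) =
      x :: (List.range n).map (fun i => (f ^ (i + 1)) x) := by
  simp [List.range_succ_eq_map]

theorem isOrb_range [Finite D] (f : Perm D) (x : D) :
    IsOrb f x ((List.range (Function.minimalPeriod f x - 1)).map (fun i => (f ^ (i + 1)) x)) := by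
  have hpos : 0 < Function.minimalPeriod f x :=
    Function.minimalPeriod_pos_of_mem_periodicPts
      (Function.Injective.mem_periodicPts f.injective x)
  obtain ⟨n, hn⟩ : ∃ n, Function.minimalPeriod f x = n + 1 :=
    ⟨_, (Nat.succ_pred_eq_of_pos hpos).symm⟩
  have hper : (f ^ (n + 1)) x = x := by
    have := Function.iterate_minimalPeriod (f := f) (x := x)
    rwa [hn, ← Perm.iterate_eq_pow] at *
  rw [hn, Nat.add_sub_cancel]
  constructor
  · rw [← map_range_eq_cons]
    have : (List.range (n + 1)).map (fun i => (f ^ i) x) ++ [x] =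
        (List.range (n + 2)).map (fun i => (f ^ i) x) := by
      rw [List.range_succ (n := n + 1), List.map_append]
      simp [hper]
    rw [this, List.isChain_map, List.isChain_range_succ]
    intro i _
    simp [pow_succ']
  · rw [← map_range_eq_cons]
    refine List.Nodup.map_on ?_ List.nodup_range
    intro i hi j hj hij
    rw [List.mem_range] at hi hj
    refine Function.iterate_injOn_Iio_minimalPeriod (f := f) (x := x) ?_ ?_ ?_
    · simpa [hn] using hi
    · simpa [hn] using hj
    · simpa [← Perm.iterate_eq_pow] using hij

theorem exists_isOrb [Finite D] (f : Perm D) (x : D) : ∃ l, IsOrb f x l := ⟨_, isOrb_range f x⟩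

theorem sameCycle_of_chain (h : List.IsChain (fun a b => f a = b) (x :: l)) (hz : z ∈ x :: l) :
    f.SameCycle x z := by
  induction l generalizing x with
  | nil => simp at hz; subst hz; rfl
  | cons a l ih =>
    rw [List.isChain_cons_cons] at h
    rcases List.mem_cons.1 hz with rfl | hz
    · rfl
    · have := ih h.2 hz
      rw [← h.1] at this
      exact Perm.sameCycle_apply_left.1 this

theorem IsOrb.sameCycle (h : IsOrb f x l) (hz : z ∈ x :: l) : f.SameCycle x z :=
  sameCycle_of_chain h.1.left_of_append hz

theorem IsOrb.apply_mem (h : IsOrb f x l) (hz : z ∈ x :: l) : f z ∈ x :: l := by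
  obtain ⟨s, t, hst⟩ := List.append_of_mem hz
  have h1 := h.1
  rw [hst, List.append_assoc, List.cons_append, List.isChain_split] at h1
  cases t with
  | nil =>
    have := h1.2
    simp at this
    simp [this]
  | cons b t =>
    have := h1.2
    simp only [List.cons_append, List.isChain_cons_cons] at this
    rw [this.1, hst]; simp

theorem IsOrb.mem_iff [Finite D] (h : IsOrb f x l) : z ∈ x :: l ↔ f.SameCycle x z := by
  refine ⟨h.sameCycle, fun hs => ?_⟩
  obtain ⟨i, rfl⟩ := hs.exists_nat_pow_eq
  induction i with
  | zero => simp
  | succ i ih =>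
    rw [pow_succ', Perm.mul_apply]
    exact h.apply_mem (ih ⟨i, by simp⟩)

theorem IsOrb.rotate (h : IsOrb f x (l ++ y :: m)) : IsOrb f y (m ++ x :: l) := by
  obtain ⟨h1, h2⟩ := h
  constructor
  · have e : x :: (l ++ y :: m) ++ [x] = (x :: l) ++ y :: (m ++ [x]) := by simp
    rw [e, List.isChain_split] at h1
    have e' : y :: (m ++ x :: l) ++ [y] = (y :: m) ++ x :: (l ++ [y]) := by simp
    rw [e', List.isChain_split]
    exact ⟨by simpa using h1.2, by simpa using h1.1⟩
  · have : (y :: (m ++ x :: l)).Perm (x :: (l ++ y :: m)) := by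
      have := List.perm_append_comm (l₁ := y :: m) (l₂ := x :: l)
      simpa using this
    exact this.nodup_iff.2 h2

theorem IsOrb.rotate_to (h : IsOrb f x l) (hy : y ∈ x :: l) :
    ∃ s t, x :: l = s ++ y :: t ∧ IsOrb f y (t ++ s) := by
  obtain ⟨s, t, hst⟩ := List.append_of_mem hy
  refine ⟨s, t, hst, ?_⟩
  cases s with
  | nil => simp at hst; obtain ⟨rfl, rfl⟩ := hst; simpa using h
  | cons a s =>
    simp at hst
    obtain ⟨rfl, rfl⟩ := hst
    exact h.rotate

theorem IsOrb.unique (h : IsOrb f x l) (h' : IsOrb f x m) : l = m := by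
  have key : ∀ (l m : List D) (a : D), List.IsChain (fun a b => f a = b) (a :: l ++ [x]) →
      List.IsChain (fun a b => f a = b) (a :: m ++ [x]) → x ∉ l → x ∉ m → l = m := by
    intro l
    induction l with
    | nil =>
      intro m a h1 h2 _ hm
      cases m with
      | nil => rfl
      | cons b m =>
        simp only [List.cons_append, List.isChain_cons_cons, List.nil_append] at h1 h2
        exact absurd (by simp [← h2.1, ← h1.1]) hm
    | cons b l ih =>
      intro m a h1 h2 hl hm
      cases m with
      | nil =>
        simp only [List.cons_append, List.isChain_cons_cons, List.nil_append] at h1 h2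
        exact absurd (by simp [← h2.1, ← h1.1]) hl
      | cons c m =>
        simp only [List.cons_append, List.isChain_cons_cons] at h1 h2
        have : b = c := h1.1.symm.trans h2.1
        subst this
        rw [ih m b h1.2 h2.2 (fun h => hl (by simp [h])) (fun h => hm (by simp [h]))]
  exact key l m x h.1 h'.1 (List.nodup_cons.1 h.2).1 (List.nodup_cons.1 h'.2).1

theorem chain_append_singleton_iff {a b : D} :
    List.IsChain (fun a b => f a = b) (a :: l ++ [b]) ↔
      List.IsChain (fun a b => f a = b) (a :: l) ∧ f ((a :: l).getLast (by simp)) = b := by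
  rw [List.isChain_append]
  simp [List.getLast?_eq_some_getLast]

variable [DecidableEq D]

theorem chain_swap_mul (h : List.IsChain (fun a b => f a = b) (z :: l)) (hx : x ∉ l) (hy : y ∉ l) :
    List.IsChain (fun a b => (swap x y * f) a = b) (z :: l) := by
  refine h.imp_of_mem_tail_imp ?_
  rintro a b - hb rfl
  simp only [List.tail_cons] at hb
  rw [Perm.mul_apply, swap_apply_of_ne_of_ne]
  · rintro rfl; exact hx hb
  · rintro rfl; exact hy hb

/-- Multiplying by the transposition of two elements of different cycles concatenates the
cycles. -/
theorem IsOrb.merge (hx : IsOrb f x l) (hy : IsOrb f y m) (hd : List.Disjoint (x :: l) (y :: m)) :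
    IsOrb (swap x y * f) x (l ++ y :: m) := by
  have hxl := (List.nodup_cons.1 hx.2).1
  have hym := (List.nodup_cons.1 hy.2).1
  have hx1 := chain_append_singleton_iff.1 hx.1
  have hy1 := chain_append_singleton_iff.1 hy.1
  constructor
  · have e : x :: (l ++ y :: m) ++ [x] = (x :: l) ++ y :: (m ++ [x]) := by simp
    rw [e, List.isChain_split, chain_append_singleton_iff, ← List.cons_append,
      chain_append_singleton_iff]
    refine ⟨⟨chain_swap_mul hx1.1 hxl fun h => hd (a := y) (by simp [h]) (by simp), ?_⟩,
      ⟨chain_swap_mul hy1.1 (fun h => hd (a := x) (by simp) (by simp [h])) hym, ?_⟩⟩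
    · rw [Perm.mul_apply, hx1.2, swap_apply_left]
    · rw [Perm.mul_apply, hy1.2, swap_apply_right]
  · rw [← List.cons_append, List.nodup_append']
    exact ⟨hx.2, hy.2, hd⟩

/-- Multiplying by the transposition of two elements of the same cycle cuts the cycle into two. -/
theorem IsOrb.split (h : IsOrb f x (l ++ y :: m)) :
    IsOrb (swap x y * f) x l ∧ IsOrb (swap x y * f) y m := by
  obtain ⟨h1, h2⟩ := h
  rw [← List.cons_append, List.nodup_append'] at h2
  obtain ⟨hl, hm, hd⟩ := h2
  have hxl := (List.nodup_cons.1 hl).1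
  have hym := (List.nodup_cons.1 hm).1
  have e : x :: (l ++ y :: m) ++ [x] = (x :: l) ++ y :: (m ++ [x]) := by simp
  rw [e, List.isChain_split, chain_append_singleton_iff, ← List.cons_append,
    chain_append_singleton_iff] at h1
  obtain ⟨⟨h1, h2⟩, h3, h4⟩ := h1
  refine ⟨⟨chain_append_singleton_iff.2
    ⟨chain_swap_mul h1 hxl fun h => hd (a := y) (by simp [h]) (by simp), ?_⟩, hl⟩,
    ⟨chain_append_singleton_iff.2
    ⟨chain_swap_mul h3 (fun h => hd (a := x) (by simp) (by simp [h])) hym, ?_⟩, hm⟩⟩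
  · rw [Perm.mul_apply, h2, swap_apply_right]
  · rw [Perm.mul_apply, h4, swap_apply_left]

theorem IsOrb.swap_mul (h : IsOrb f z l) (hx : x ∉ z :: l) (hy : y ∉ z :: l) :
    IsOrb (swap x y * f) z l := by
  refine ⟨?_, h.2⟩
  refine chain_swap_mul (z := z) (l := l ++ [z]) h.1 ?_ ?_
  · simp at hx ⊢; tauto
  · simp at hy ⊢; tauto

variable [Finite D]

theorem sameCycle_swap_mul (h : ¬ f.SameCycle x y) : (swap x y * f).SameCycle x y := by
  obtain ⟨l, hl⟩ := exists_isOrb f x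
  obtain ⟨m, hm⟩ := exists_isOrb f y
  refine (hl.merge hm ?_).sameCycle (by simp)
  intro a ha hb
  exact h ((hl.sameCycle ha).trans (hm.sameCycle hb).symm)

theorem not_sameCycle_swap_mul (hne : x ≠ y) (h : f.SameCycle x y) :
    ¬ (swap x y * f).SameCycle x y := by
  obtain ⟨l, hl⟩ := exists_isOrb f x
  have hy := hl.mem_iff.2 h
  obtain ⟨s, t, rfl⟩ := List.append_of_mem ((List.mem_cons.1 hy).resolve_left (Ne.symm hne))
  rw [← hl.split.1.mem_iff]
  have := hl.2
  rw [← List.cons_append, List.nodup_append'] at this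
  exact fun h => this.2.2 h (by simp)

end Orb

/-! ### Counting classes -/

section Classes

variable {D : Type*}

/-- The number of classes of an equivalence relation (`0` if there are infinitely many). -/
noncomputable def classes (r : Setoid D) : ℕ := Nat.card (Quotient r)

theorem classes_anti [Finite D] {r s : Setoid D} (h : r ≤ s) : classes s ≤ classes r :=
  Nat.card_le_card_of_surjective (Quotient.map' id h) fun q => by
    induction q using Quotient.inductionOn with | _ a => exact ⟨Quotient.mk r a, rfl⟩

theorem classes_lt [Finite D] {r s : Setoid D} (h : r ≤ s) {x y : D} (hs : s x y) (hr : ¬ r x y) :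
    classes s + 1 ≤ classes r := by
  have hsurj : Function.Surjective (Quotient.map' id h : Quotient r → Quotient s) := fun q => by
    induction q using Quotient.inductionOn with | _ a => exact ⟨Quotient.mk r a, rfl⟩
  refine lt_of_le_of_ne (classes_anti h) fun heq => hr ?_
  have hb := (Nat.bijective_iff_surjective_and_card (Quotient.map' id h :
    Quotient r → Quotient s)).2 ⟨hsurj, heq.symm⟩
  exact Quotient.exact (hb.1 (Quotient.sound hs :
    (Quotient.map' id h (Quotient.mk r x) : Quotient s) = Quotient.map' id h (Quotient.mk r y)))

open Classical in
/-- The equivalence relation obtained from `r` by joining the classes of `x` and `y`. -/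
noncomputable def glue (r : Setoid D) (x y : D) : Setoid D :=
  Setoid.ker fun a => if r a y then (Quotient.mk r x) else Quotient.mk r a

theorem le_glue (r : Setoid D) (x y : D) : r ≤ glue r x y := by
  classical
  intro a b hab
  show (if r a y then (Quotient.mk r x) else Quotient.mk r a) =
    (if r b y then (Quotient.mk r x) else Quotient.mk r b)
  have : r a y ↔ r b y := ⟨fun h => r.trans (r.symm hab) h, fun h => r.trans hab h⟩
  simp only [this]
  split_ifs
  · rfl
  · exact Quotient.sound hab

theorem glue_rel (r : Setoid D) (x y : D) : glue r x y x y := by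
  classical
  show (if r x y then (Quotient.mk r x) else Quotient.mk r x) =
    (if r y y then (Quotient.mk r x) else Quotient.mk r y)
  rw [if_pos (r.refl y)]
  split_ifs <;> rfl

theorem classes_le_glue [Finite D] (r : Setoid D) (x y : D) :
    classes r ≤ classes (glue r x y) + 1 := by
  classical
  have : Nat.card (Option (Quotient (glue r x y))) = classes (glue r x y) + 1 :=
    Finite.card_option
  rw [← this]
  refine Nat.card_le_card_of_injective (fun q : Quotient r =>
    if q = Quotient.mk r y then none else some (Quotient.map' id (le_glue r x y) q)) ?_
  intro p q h
  induction p using Quotient.inductionOn with | _ a => ?_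
  induction q using Quotient.inductionOn with | _ b => ?_
  simp only at h
  split_ifs at h with h1 h2 h2
  · exact h1.trans h2.symm
  · have h3 : glue r x y a b := Quotient.exact (Option.some.inj h)
    have h4 : ite _ _ _ = ite _ _ _ := h3
    rwa [if_neg fun h => h1 (Quotient.sound h), if_neg fun h => h2 (Quotient.sound h)] at h4

/-- The partition into the cycles of `f`. -/
abbrev cyc (f : Perm D) : Setoid D := Perm.SameCycle.setoid f

theorem cyc_le_iff {f : Perm D} {r : Setoid D} : cyc f ≤ r ↔ ∀ z, r z (f z) := by
  constructor
  · intro h z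
    exact h (show f.SameCycle z (f z) from Perm.sameCycle_apply_right.2 (Perm.SameCycle.refl _ _))
  · rintro h a b ⟨i, rfl⟩
    induction i using Int.induction_on with
    | zero => exact r.refl _
    | succ i ih =>
      rw [add_comm, zpow_add, zpow_one, Perm.mul_apply]
      exact r.trans ih (h _)
    | pred i ih =>
      refine r.trans ih (r.symm ?_)
      have := h ((f ^ (-(i : ℤ) - 1)) a)
      rwa [← Perm.mul_apply, ← zpow_one_add, add_sub_cancel] at this

theorem rel_apply {f : Perm D} {r : Setoid D} (h : cyc f ≤ r) (z : D) : r z (f z) :=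
  cyc_le_iff.1 h z

variable [DecidableEq D]

theorem cyc_swap_mul_le {f : Perm D} {r : Setoid D} {x y : D} (h : cyc f ≤ r) (hxy : r x y) :
    cyc (swap x y * f) ≤ r := by
  rw [cyc_le_iff] at h ⊢
  intro z
  rw [Perm.mul_apply]
  have := h z
  rcases eq_or_ne (f z) x with hx | hx
  · rw [hx, swap_apply_left]; rw [hx] at this; exact r.trans this hxy
  · rcases eq_or_ne (f z) y with hy | hy
    · rw [hy, swap_apply_right]; rw [hy] at this; exact r.trans this (r.symm hxy)
    · rwa [swap_apply_of_ne_of_ne hx hy]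

theorem cyc_le_of_swap_mul {f : Perm D} {r : Setoid D} {x y : D} (h : cyc (swap x y * f) ≤ r)
    (hxy : r x y) : cyc f ≤ r := by
  have := cyc_swap_mul_le h hxy
  rwa [← mul_assoc, swap_mul_self, one_mul] at this

theorem classes_cyc_le_swap_mul [Finite D] (f : Perm D) (x y : D) :
    classes (cyc f) ≤ classes (cyc (swap x y * f)) + 1 :=
  (classes_le_glue (cyc f) x y).trans <| Nat.add_le_add_right
    (classes_anti (cyc_swap_mul_le (le_glue _ _ _) (glue_rel _ _ _))) 1

theorem classes_cyc_swap_mul [Finite D] {f : Perm D} {x y : D} (hne : x ≠ y)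
    (h : f.SameCycle x y) : classes (cyc f) + 1 ≤ classes (cyc (swap x y * f)) :=
  classes_lt (r := cyc (swap x y * f)) (s := cyc f) (cyc_swap_mul_le le_rfl h) h
    (not_sameCycle_swap_mul hne h)

end Classes

/-! ### Genus -/

section Genus

variable {D : Type*}

/-- The partition of the darts into the connected components of the map with vertex permutation
`σ` and edge involution `τ`. -/
abbrev comps (σ τ : Perm D) : Setoid D := cyc σ ⊔ cyc τ

/-- Twice the sum of the genera of the components of the map with vertex permutation `σ` and edge
involution `τ`: the difference between twice the number of components and the Euler
characteristic. The faces are the cycles of `σ * τ`, and the number of edges is written as the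
number of cycles of `τ`. The darts are supposed to be finite in number. -/
noncomputable def genus2 (σ τ : Perm D) : ℤ :=
  2 * classes (comps σ τ) - classes (cyc σ) + classes (cyc τ) - classes (cyc (σ * τ))

theorem comps_vertex (σ τ : Perm D) (z : D) : comps σ τ z (σ z) :=
  rel_apply le_sup_left z

theorem comps_edge (σ τ : Perm D) (z : D) : comps σ τ z (τ z) :=
  rel_apply le_sup_right z

theorem cyc_face_le {σ τ : Perm D} {r : Setoid D} (h : comps σ τ ≤ r) : cyc (σ * τ) ≤ r :=
  cyc_le_iff.2 fun z => r.trans (h (comps_edge σ τ z)) (h (comps_vertex σ τ (τ z)))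

theorem comps_of_vertex {σ τ : Perm D} {x y : D} (h : σ.SameCycle x y) : comps σ τ x y :=
  (le_sup_left : cyc σ ≤ comps σ τ) h

theorem comps_of_face {σ τ : Perm D} {x y : D} (h : (σ * τ).SameCycle x y) : comps σ τ x y :=
  cyc_face_le le_rfl h

variable [DecidableEq D] {σ τ : Perm D} {x y : D}

theorem comps_swap_le {r : Setoid D} (h : comps σ τ ≤ r) (hxy : r x y) :
    comps (swap x y * σ) τ ≤ r :=
  sup_le (cyc_swap_mul_le (le_sup_left.trans h) hxy) (le_sup_right.trans h)

theorem comps_le_of_swap {r : Setoid D} (h : comps (swap x y * σ) τ ≤ r) (hxy : r x y) :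
    comps σ τ ≤ r :=
  sup_le (cyc_le_of_swap_mul (le_sup_left.trans h) hxy) (le_sup_right.trans h)

variable [Finite D]

theorem classes_comps_swap_le :
    classes (comps (swap x y * σ) τ) ≤ classes (comps σ τ) + 1 :=
  (classes_le_glue _ x y).trans <| Nat.add_le_add_right
    (classes_anti (comps_le_of_swap (le_glue _ _ _) (glue_rel _ _ _))) 1

/-- Cutting a vertex in two, or joining two vertices across a face, does not increase the
genus. -/
theorem genus2_swap_le (hne : x ≠ y) (h : σ.SameCycle x y ∨ (σ * τ).SameCycle x y) :
    genus2 (swap x y * σ) τ ≤ genus2 σ τ := by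
  unfold genus2
  rw [mul_assoc]
  by_cases h1 : σ.SameCycle x y
  · have e1 := classes_cyc_swap_mul hne h1
    by_cases h2 : (σ * τ).SameCycle x y
    · have e2 := classes_cyc_swap_mul hne h2
      have e3 := classes_comps_swap_le (σ := σ) (τ := τ) (x := x) (y := y)
      omega
    · have e2 := classes_cyc_le_swap_mul (σ * τ) x y
      have h3 : comps (swap x y * σ) τ x y := comps_of_face (by
        rw [mul_assoc]; exact sameCycle_swap_mul h2)
      have e3 := classes_anti (comps_le_of_swap (σ := σ) le_rfl h3)
      omega
  · have e1 := classes_cyc_le_swap_mul σ x y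
    have e2 := classes_cyc_swap_mul hne (h.resolve_left h1)
    have h3 : comps (swap x y * σ) τ x y := comps_of_vertex (sameCycle_swap_mul h1)
    have e3 := classes_anti (comps_le_of_swap (σ := σ) le_rfl h3)
    omega

/-- Cutting a vertex in two across a face cuts a handle if it does not disconnect. -/
theorem genus2_swap_le_sub (hne : x ≠ y) (h1 : σ.SameCycle x y) (h2 : (σ * τ).SameCycle x y)
    (h3 : comps (swap x y * σ) τ x y) : genus2 (swap x y * σ) τ ≤ genus2 σ τ - 2 := by
  unfold genus2
  rw [mul_assoc]
  have e1 := classes_cyc_swap_mul hne h1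
  have e2 := classes_cyc_swap_mul hne h2
  have e3 := classes_anti (comps_le_of_swap (σ := σ) le_rfl h3)
  omega

/-- Joining vertices of different components does not increase the genus. -/
theorem genus2_swap_le_of_not_comps (h : ¬ comps σ τ x y) :
    genus2 (swap x y * σ) τ ≤ genus2 σ τ := by
  unfold genus2
  rw [mul_assoc]
  have e1 := classes_cyc_le_swap_mul σ x y
  have e2 := classes_cyc_le_swap_mul (σ * τ) x y
  have h3 : comps (swap x y * σ) τ x y :=
    comps_of_vertex (sameCycle_swap_mul fun h' => h (comps_of_vertex h'))
  have e3 := classes_lt (comps_le_of_swap (σ := σ) le_rfl h3) h3 h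
  omega

omit [DecidableEq D] [Finite D] in
theorem card_eq_two_mul_classes (hτ : ∀ d, τ (τ d) = d) (hτ' : ∀ d, τ d ≠ d) :
    Nat.card D = 2 * classes (cyc τ) := by
  have hmem : ∀ a b, τ.SameCycle a b → b = a ∨ b = τ a := by
    rintro a b ⟨i, rfl⟩
    have h2 : τ ^ (2 : ℤ) = 1 := by ext d; rw [zpow_two]; exact hτ d
    rcases Int.even_or_odd' i with ⟨k, rfl | rfl⟩
    · left; rw [zpow_mul, h2, one_zpow, Perm.one_apply]
    · right; rw [zpow_add, zpow_mul, h2, one_zpow, zpow_one, one_mul]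
  have hb : Function.Bijective (fun p : Quotient (cyc τ) × Bool =>
      if p.2 then p.1.out else τ p.1.out) := by
    have hq : ∀ p : Quotient (cyc τ) × Bool,
        Quotient.mk (cyc τ) (if p.2 then p.1.out else τ p.1.out) = p.1 := by
      rintro ⟨q, b⟩
      cases b
      · refine Eq.trans (Quotient.sound ?_) (Quotient.out_eq q)
        exact (cyc τ).symm (rel_apply le_rfl _)
      · exact Quotient.out_eq q
    constructor
    · rintro ⟨q, b⟩ ⟨q', b'⟩ h
      have e : q = q' := (hq (q, b)).symm.trans ((congrArg _ h).trans (hq (q', b')))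
      subst e
      cases b <;> cases b' <;> simp at h ⊢
      · exact hτ' _ h
      · exact hτ' _ h.symm
    · intro d
      have : τ.SameCycle (Quotient.mk (cyc τ) d).out d := Quotient.mk_out (s := cyc τ) d
      rcases hmem _ _ this with h | h
      · exact ⟨(Quotient.mk _ d, true), h.symm⟩
      · exact ⟨(Quotient.mk _ d, false), h.symm⟩
  have := Nat.card_congr (Equiv.ofBijective _ hb)
  rw [Nat.card_prod] at this
  rw [← this]
  simp [classes, mul_comm]

omit [DecidableEq D] [Finite D] in
theorem genus2_one (hτ : ∀ d, τ (τ d) = d) (hτ' : ∀ d, τ d ≠ d) : genus2 1 τ = 0 := by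
  have h0 : cyc (1 : Perm D) = ⊥ := by
    ext a b; exact Perm.sameCycle_one
  have h1 : comps 1 τ = cyc τ := by rw [comps, h0, bot_sup_eq]
  have h2 : classes (cyc (1 : Perm D)) = Nat.card D := by
    rw [h0]
    exact (Nat.card_congr (Equiv.ofBijective (Quotient.mk (⊥ : Setoid D))
      ⟨fun a b h => Quotient.exact h, Quotient.mk_surjective⟩)).symm
  rw [genus2, h1, h2, one_mul, card_eq_two_mul_classes hτ hτ']
  push_cast
  ring

omit [DecidableEq D] in
/-- The genus is nonnegative: it does not increase when darts are cut off from their vertices, and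
it is zero when all vertices are univalent. -/
theorem genus2_nonneg (hτ : ∀ d, τ (τ d) = d) (hτ' : ∀ d, τ d ≠ d) (σ : Perm D) :
    0 ≤ genus2 σ τ := by
  classical
  have := Fintype.ofFinite D
  induction hn : σ.support.card using Nat.strong_induction_on generalizing σ with
  | _ n ih =>
    by_cases h : ∃ x, σ x ≠ x
    · obtain ⟨x, hx⟩ := h
      refine (ih _ ?_ (swap x (σ x) * σ) rfl).trans (genus2_swap_le (Ne.symm hx)
        (Or.inl (Perm.sameCycle_apply_right.2 (Perm.SameCycle.refl _ _))))
      rw [← hn]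
      exact Perm.card_support_swap_mul hx
    · push Not at h
      obtain rfl : σ = 1 := Equiv.ext h
      rw [genus2_one hτ hτ']

end Genus

/-! ### Holonomy -/

section Holonomy

variable {D : Type*} {G : Type*} [Group G]

/-- The label of `d` after the change of gauge `p`; the dart `d` leads from the corner just before
it to the corner just before `σ d`. -/
def gauged (σ : Perm D) (lam : D → G) (p : D → G) (d : D) : G := p d * lam d * (p (σ d))⁻¹

/-- After a suitable change of gauge `p`, constant on faces, all labels lie in the subgroup `K`,
and the nontrivial ones occur in one component only. A dart `d` stands for the corner just before
it, and the cycles of `σ * τ` are the faces. -/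
def HolonomyIn (σ τ : Perm D) (lam : D → G) (K : Subgroup G) : Prop :=
  ∃ p : D → G, (∀ d, p (σ (τ d)) = p d) ∧ (∀ d, gauged σ lam p d ∈ K) ∧
    ∀ a b, gauged σ lam p a ≠ 1 → gauged σ lam p b ≠ 1 → comps σ τ a b

theorem holonomyIn_bot_iff {σ τ : Perm D} {lam : D → G} : HolonomyIn σ τ lam ⊥ ↔
    ∃ p : D → G, (∀ d, p (σ (τ d)) = p d) ∧ ∀ d, gauged σ lam p d = 1 := by
  constructor
  · rintro ⟨p, h1, h2, -⟩
    exact ⟨p, h1, fun d => Subgroup.mem_bot.1 (h2 d)⟩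
  · rintro ⟨p, h1, h2⟩
    exact ⟨p, h1, fun d => Subgroup.mem_bot.2 (h2 d), fun a b ha => absurd (h2 a) ha⟩

theorem eq_of_sameCycle {G : Type*} {f : Perm D} {p : D → G} (h : ∀ d, p (f d) = p d) {x y : D}
    (hs : f.SameCycle x y) : p x = p y :=
  (cyc_le_iff (r := Setoid.ker p)).2 (fun z => (h z).symm) hs

/-- The product of consecutive labels around a vertex is, up to the gauge at both ends, a product of
gauged labels. -/
theorem prod_mem_of_chain {σ : Perm D} {lam : D → G} {p : D → G} {K : Subgroup G} {x y : D}
    {l : List D} (h : List.IsChain (fun a b => σ a = b) (x :: l ++ [y]))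
    (hK : ∀ z ∈ x :: l, gauged σ lam p z ∈ K) :
    p x * ((x :: l).map lam).prod * (p y)⁻¹ ∈ K := by
  induction l generalizing x with
  | nil =>
    have : σ x = y := by simpa using h
    subst this
    simpa [gauged] using hK x (by simp)
  | cons a l ih =>
    simp only [List.cons_append, List.isChain_cons_cons] at h
    have h1 := hK x (by simp)
    have h2 := ih (x := a) h.2 fun z hz => hK z (List.mem_cons_of_mem _ hz)
    have := K.mul_mem h1 h2
    rw [gauged, h.1] at this
    rw [List.map_cons, List.prod_cons]
    convert this using 1
    group

variable [DecidableEq D] {σ τ : Perm D} {lam : D → G} {x y : D}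

omit [Group G] in
theorem face_const_of_swap {p : D → G} (h : ∀ d, p ((swap x y * σ) (τ d)) = p d)
    (hxy : p x = p y) (d : D) : p (σ (τ d)) = p d := by
  rw [← h d, Perm.mul_apply]
  rcases eq_or_ne (σ (τ d)) x with h1 | h1
  · rw [h1, swap_apply_left, hxy]
  · rcases eq_or_ne (σ (τ d)) y with h2 | h2
    · rw [h2, swap_apply_right, hxy]
    · rw [swap_apply_of_ne_of_ne h1 h2]

theorem gauged_swap {p : D → G} (hxy : p x = p y) (d : D) :
    gauged (swap x y * σ) lam p d = gauged σ lam p d := by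
  unfold gauged
  rw [Perm.mul_apply]
  rcases eq_or_ne (σ d) x with h1 | h1
  · rw [h1, swap_apply_left, hxy]
  · rcases eq_or_ne (σ d) y with h2 | h2
    · rw [h2, swap_apply_right, hxy]
    · rw [swap_apply_of_ne_of_ne h1 h2]

/-- A gauge that agrees at the corners before `x` and `y` serves for both `swap x y * σ` and `σ`. -/
theorem HolonomyIn.of_swap {K : Subgroup G} {p : D → G} (hxy : comps σ τ x y)
    (h : ∀ d, p ((swap x y * σ) (τ d)) = p d) (hp : p x = p y)
    (hK : ∀ d, gauged (swap x y * σ) lam p d ∈ K)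
    (hc : ∀ a b, gauged (swap x y * σ) lam p a ≠ 1 → gauged (swap x y * σ) lam p b ≠ 1 →
      comps (swap x y * σ) τ a b) : HolonomyIn σ τ lam K := by
  simp only [gauged_swap hp] at hK hc
  exact ⟨p, face_const_of_swap h hp, hK, fun a b ha hb =>
    comps_swap_le le_rfl hxy (hc a b ha hb)⟩

omit [DecidableEq D] in
/-- Where the gauged labels of the component of `w` are trivial, the gauge of the component can be
translated without changing any gauged label. -/
theorem exists_translate {p : D → G} (h : ∀ d, p (σ (τ d)) = p d) (w : D) (g : G)
    (hw : ∀ z, comps σ τ w z → gauged σ lam p z = 1) :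
    ∃ q : D → G, (∀ d, q (σ (τ d)) = q d) ∧ (∀ d, gauged σ lam q d = gauged σ lam p d) ∧
      (∀ z, comps σ τ w z → q z = g * p z) ∧ ∀ z, ¬ comps σ τ w z → q z = p z := by
  classical
  have hv : ∀ d, comps σ τ w (σ d) ↔ comps σ τ w d := fun d =>
    ⟨fun h => (comps σ τ).trans h ((comps σ τ).symm (comps_vertex σ τ d)),
      fun h => (comps σ τ).trans h (comps_vertex σ τ d)⟩
  have he : ∀ d, comps σ τ w (τ d) ↔ comps σ τ w d := fun d =>
    ⟨fun h => (comps σ τ).trans h ((comps σ τ).symm (comps_edge σ τ d)),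
      fun h => (comps σ τ).trans h (comps_edge σ τ d)⟩
  refine ⟨fun z => if comps σ τ w z then g * p z else p z, fun d => ?_, fun d => ?_,
    fun z hz => if_pos hz, fun z hz => if_neg hz⟩
  · simp only [hv, he, h]
  · by_cases hd : comps σ τ w d
    · rw [hw d hd]
      have := hw d hd
      unfold gauged at this ⊢
      dsimp only
      rw [if_pos hd, if_pos ((hv d).2 hd), mul_inv_rev]
      rw [show g * p d * lam d * ((p (σ d))⁻¹ * g⁻¹) = g * (p d * lam d * (p (σ d))⁻¹) * g⁻¹ by
        group, this, mul_one, mul_inv_cancel]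
    · unfold gauged
      dsimp only
      rw [if_neg hd, if_neg fun h => hd ((hv d).1 h)]

omit [DecidableEq D] in
/-- Translation of a gauge, on a single face, by an element of `K`. -/
theorem exists_translate_face {p : D → G} {K : Subgroup G} (h : ∀ d, p (σ (τ d)) = p d) (w : D)
    {g : G} (hg : g ∈ K) (hK : ∀ d, gauged σ lam p d ∈ K) :
    ∃ q : D → G, (∀ d, q (σ (τ d)) = q d) ∧ (∀ d, gauged σ lam q d ∈ K) ∧
      (∀ d, gauged σ lam q d = gauged σ lam p d ∨ comps σ τ w d) ∧
      (∀ z, (σ * τ).SameCycle w z → q z = g * p z) ∧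
      ∀ z, ¬ (σ * τ).SameCycle w z → q z = p z := by
  classical
  refine ⟨fun z => if (σ * τ).SameCycle w z then g * p z else p z, fun d => ?_, fun d => ?_,
    fun d => ?_, fun z hz => if_pos hz, fun z hz => if_neg hz⟩
  · have : (σ * τ).SameCycle w (σ (τ d)) ↔ (σ * τ).SameCycle w d := Perm.sameCycle_apply_right
    simp only [this, h]
  · have := hK d
    unfold gauged at this ⊢
    dsimp only
    split_ifs
    · rw [show g * p d * lam d * (g * p (σ d))⁻¹ = g * (p d * lam d * (p (σ d))⁻¹) * g⁻¹ by group]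
      exact K.mul_mem (K.mul_mem hg this) (K.inv_mem hg)
    · rw [show g * p d * lam d * (p (σ d))⁻¹ = g * (p d * lam d * (p (σ d))⁻¹) by group]
      exact K.mul_mem hg this
    · rw [show p d * lam d * (g * p (σ d))⁻¹ = (p d * lam d * (p (σ d))⁻¹) * g⁻¹ by group]
      exact K.mul_mem this (K.inv_mem hg)
    · exact this
  · by_cases h1 : (σ * τ).SameCycle w d
    · exact Or.inr (comps_of_face h1)
    · by_cases h2 : (σ * τ).SameCycle w (σ d)
      · exact Or.inr ((comps σ τ).trans (comps_of_face h2) ((comps σ τ).symm (comps_vertex σ τ d)))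
      · left; unfold gauged; dsimp only; rw [if_neg h1, if_neg h2]

variable [Finite D]

theorem sameCycle_face_swap (h : ¬ (σ * τ).SameCycle x y) :
    ((swap x y * σ) * τ).SameCycle x y := by
  rw [mul_assoc]; exact sameCycle_swap_mul h

omit [Group G] in
theorem eq_of_not_face {p : D → G} (h : ∀ d, p ((swap x y * σ) (τ d)) = p d)
    (hf : ¬ (σ * τ).SameCycle x y) : p x = p y :=
  eq_of_sameCycle (f := (swap x y * σ) * τ) h (sameCycle_face_swap hf)

omit [Finite D] in
/-- If a map becomes flat after a vertex has been cut in two, then its holonomy is cyclic, generated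
by the holonomy of a closed curve meeting the graph in that vertex only. -/
theorem HolonomyIn.of_split_bot (hv : σ.SameCycle x y)
    (h : HolonomyIn (swap x y * σ) τ lam ⊥) : ∃ c, HolonomyIn σ τ lam (Subgroup.zpowers c) := by
  obtain ⟨p, hp, h1⟩ := holonomyIn_bot_iff.1 h
  by_cases hxy : p x = p y
  · exact ⟨1, HolonomyIn.of_swap (comps_of_vertex hv) hp hxy
      (fun d => by rw [h1 d]; exact one_mem _) fun a b ha => absurd (h1 a) ha⟩
  · have hne : ¬ ((swap x y * σ) * τ).SameCycle x y := fun hs =>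
      hxy (eq_of_sameCycle (f := (swap x y * σ) * τ) hp hs)
    obtain ⟨q, hq1, hq2, hq3, hq4, hq5⟩ := exists_translate_face (lam := lam)
      (K := Subgroup.zpowers (p x * (p y)⁻¹)) hp y
      (Subgroup.mem_zpowers _) (fun d => by rw [h1 d]; exact one_mem _)
    refine ⟨_, HolonomyIn.of_swap (comps_of_vertex hv) hq1 ?_ hq2 fun a b ha hb => ?_⟩
    · rw [hq5 x fun h => hne h.symm, hq4 y (Perm.SameCycle.refl _ _)]
      group
    · have e1 := (hq3 a).resolve_left (by rwa [h1 a])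
      have e2 := (hq3 b).resolve_left (by rwa [h1 b])
      exact (comps _ τ).trans ((comps _ τ).symm e1) e2

omit [Finite D] in
/-- If cutting a vertex in two disconnects its component, the holonomy does not change: one of
the two parts is flat, and its gauge can be adapted to that of the other. -/
theorem HolonomyIn.of_split_of_not_comps {K : Subgroup G} (hv : σ.SameCycle x y)
    (hcon : ¬ comps (swap x y * σ) τ x y) (h : HolonomyIn (swap x y * σ) τ lam K) :
    HolonomyIn σ τ lam K := by
  obtain ⟨p, hp, h1, h2⟩ := h
  by_cases hfl : ∀ z, comps (swap x y * σ) τ y z → gauged (swap x y * σ) lam p z = 1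
  · obtain ⟨q, hq1, hq2, hq3, hq4⟩ := exists_translate hp y (p x * (p y)⁻¹) hfl
    refine HolonomyIn.of_swap (comps_of_vertex hv) hq1 ?_ (fun d => by rw [hq2]; exact h1 d)
      fun a b => by rw [hq2, hq2]; exact h2 a b
    rw [hq4 x fun h => hcon ((comps _ τ).symm h), hq3 y ((comps _ τ).refl _)]
    group
  · push Not at hfl
    obtain ⟨b, hb, hb1⟩ := hfl
    obtain ⟨q, hq1, hq2, hq3, hq4⟩ := exists_translate hp x (p y * (p x)⁻¹) (lam := lam)
      fun z hz => by
        by_contra hz1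
        exact hcon ((comps _ τ).trans hz ((comps _ τ).trans (h2 z b hz1 hb1) ((comps _ τ).symm hb)))
    refine HolonomyIn.of_swap (comps_of_vertex hv) hq1 ?_ (fun d => by rw [hq2]; exact h1 d)
      fun a b => by rw [hq2, hq2]; exact h2 a b
    rw [hq4 y hcon, hq3 x ((comps _ τ).refl _)]
    group

/-- Joining two vertices across a face, the labels around one of them having product `1`, does not
change the holonomy. -/
theorem HolonomyIn.of_merge {K : Subgroup G} {l m : List D} (hx : IsOrb σ x l) (hy : IsOrb σ y m)
    (hv : ¬ σ.SameCycle x y) (hf : (σ * τ).SameCycle x y) (h1 : ((x :: l).map lam).prod = 1)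
    (h : HolonomyIn (swap x y * σ) τ lam K) : HolonomyIn σ τ lam K := by
  obtain ⟨p, hp, hK, hc⟩ := h
  have hne : x ≠ y := by rintro rfl; exact hv (Perm.SameCycle.refl _ _)
  have hd : List.Disjoint (x :: l) (y :: m) := fun a ha hb =>
    hv ((hx.sameCycle ha).trans (hy.sameCycle hb).symm)
  have horb := hx.merge hy hd
  have hchain : List.IsChain (fun a b => (swap x y * σ) a = b) (x :: l ++ [y]) := by
    have := horb.1
    rw [List.cons_append, List.append_assoc, List.cons_append, List.isChain_cons_split] at this
    exact this.1
  have hg : ∀ K' : Subgroup G, (∀ z ∈ x :: l, gauged (swap x y * σ) lam p z ∈ K') →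
      p x * (p y)⁻¹ ∈ K' := by
    intro K' hK'
    have := prod_mem_of_chain hchain hK'
    rwa [h1, mul_one] at this
  have hfn : ¬ ((swap x y * σ) * τ).SameCycle x y := by
    rw [mul_assoc]; exact not_sameCycle_swap_mul hne hf
  obtain ⟨q, hq1, hq2, hq3, hq4, hq5⟩ := exists_translate_face hp y (hg K fun z _ => hK z) hK
  have hqxy : q x = q y := by
    rw [hq5 x fun h => hfn h.symm, hq4 y (Perm.SameCycle.refl _ _)]
    group
  by_cases hgt : p x = p y
  · exact HolonomyIn.of_swap (comps_of_face hf) hp hgt hK hc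
  · obtain ⟨b, hb, hb1⟩ : ∃ b ∈ x :: l, gauged (swap x y * σ) lam p b ≠ 1 := by
      by_contra hcon
      push Not at hcon
      have := hg ⊥ fun z hz => Subgroup.mem_bot.2 (hcon z hz)
      exact hgt (mul_inv_eq_one.1 (Subgroup.mem_bot.1 this))
    have hby : comps (swap x y * σ) τ y b :=
      (comps _ τ).trans ((comps _ τ).symm (comps_of_vertex (horb.sameCycle (by simp))))
        (comps_of_vertex (horb.sameCycle (z := b) (by
          rw [← List.cons_append]; exact List.mem_append_left _ hb)))
    have key : ∀ a, gauged (swap x y * σ) lam q a ≠ 1 → comps (swap x y * σ) τ y a := by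
      intro a ha
      rcases hq3 a with h | h
      · exact (comps _ τ).trans hby (hc b a hb1 (by rwa [← h]))
      · exact h
    exact HolonomyIn.of_swap (comps_of_face hf) hq1 hqxy hq2 fun a b ha hb =>
      (comps _ τ).trans ((comps _ τ).symm (key a ha)) (key b hb)

/-- The labels with those of the edge of `d` made trivial. -/
def erase (τ : Perm D) (d : D) {G : Type*} [One G] (lam : D → G) (z : D) : G :=
  if z = d ∨ z = τ d then 1 else lam z

omit [Finite D] in
/-- A loop bounding a disc has no influence on the holonomy. -/
theorem HolonomyIn.of_erase {K : Subgroup G} {d : D} (hτ' : ∀ d, τ d ≠ d) (hd : σ (τ d) = d)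
    (hlam : lam (τ d) * lam d = 1) (h : HolonomyIn σ τ (erase τ d lam) K) :
    HolonomyIn σ τ lam K := by
  obtain ⟨p, hp, hK, hc⟩ := h
  have hdd : σ d ≠ d := fun h => hτ' d (σ.injective (hd.trans h.symm))
  let q : D → G := fun z => if z = d then p (τ d) * lam (τ d) else p z
  have hq : ∀ z, z ≠ d → q z = p z := fun z hz => if_neg hz
  have hqd : q d = p (τ d) * lam (τ d) := if_pos rfl
  have e1 : gauged σ (erase τ d lam) p (τ d) = p (τ d) * (p d)⁻¹ := by
    simp [gauged, erase, hd]
  have e2 : gauged σ (erase τ d lam) p d = p d * (p (σ d))⁻¹ := by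
    simp [gauged, erase]
  have g1 : gauged σ lam q (τ d) = 1 := by
    unfold gauged
    rw [hd, hqd, hq _ (hτ' d)]
    group
  have g2 : gauged σ lam q d =
      gauged σ (erase τ d lam) p (τ d) * gauged σ (erase τ d lam) p d := by
    rw [e1, e2, gauged, hqd, hq _ hdd, mul_assoc (p (τ d)), hlam]
    group
  have g3 : ∀ z, z ≠ d → z ≠ τ d → gauged σ lam q z = gauged σ (erase τ d lam) p z := by
    intro z h1 h2
    have h3 : σ z ≠ d := fun h => h2 (σ.injective (h.trans hd.symm))
    unfold gauged erase
    rw [hq z h1, hq _ h3, if_neg (by tauto)]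
  have key : ∀ z, gauged σ lam q z ≠ 1 →
      ∃ z', comps σ τ z z' ∧ gauged σ (erase τ d lam) p z' ≠ 1 := by
    intro z hz
    by_cases h1 : z = d
    · subst h1
      by_cases h2 : gauged σ (erase τ z lam) p z = 1
      · refine ⟨τ z, comps_edge _ _ _, fun h3 => hz ?_⟩
        rw [g2, h2, h3, one_mul]
      · exact ⟨z, (comps σ τ).refl _, h2⟩
    · by_cases h2 : z = τ d
      · subst h2; exact absurd g1 hz
      · exact ⟨z, (comps σ τ).refl _, by rwa [← g3 z h1 h2]⟩
  refine ⟨q, fun z => ?_, fun z => ?_, fun a b ha hb => ?_⟩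
  · by_cases hz : z = d
    · rw [hz, hd]
    · rw [hq z hz, hq _ fun h => hz (τ.injective (σ.injective (h.trans hd.symm))), hp]
  · by_cases h1 : z = d
    · subst h1; rw [g2]; exact K.mul_mem (hK _) (hK _)
    · by_cases h2 : z = τ d
      · subst h2; rw [g1]; exact K.one_mem
      · rw [g3 z h1 h2]; exact hK _
  · obtain ⟨a', ha1, ha2⟩ := key a ha
    obtain ⟨b', hb1, hb2⟩ := key b hb
    exact (comps σ τ).trans ha1 ((comps σ τ).trans (hc a' b' ha2 hb2) ((comps σ τ).symm hb1))

end Holonomy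

/-! ### Vertex products -/

section Vertex

variable {D : Type*} {F : Type*} [Group F]

/-- `w` is trivial or a conjugate of an element of `R`. -/
def TrivialOrConj (R : Set F) (w : F) : Prop := w = 1 ∨ ∃ g, ∃ r ∈ R, w = g * r * g⁻¹

theorem TrivialOrConj.conj {R : Set F} {w : F} (h : TrivialOrConj R w) (g : F) :
    TrivialOrConj R (g * w * g⁻¹) := by
  rcases h with rfl | ⟨k, r, hr, rfl⟩
  · left; group
  · exact Or.inr ⟨g * k, r, hr, by group⟩

theorem TrivialOrConj.swap {R : Set F} {v w : F} (h : TrivialOrConj R (v * w)) :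
    TrivialOrConj R (w * v) := by
  have := h.conj v⁻¹
  rwa [show v⁻¹ * (v * w) * v⁻¹⁻¹ = w * v by group] at this

theorem TrivialOrConj.mem_normalClosure {R : Set F} {w : F} (h : TrivialOrConj R w) :
    w ∈ Subgroup.normalClosure R := by
  rcases h with rfl | ⟨g, r, hr, rfl⟩
  · exact one_mem _
  · exact Subgroup.normalClosure_normal.conj_mem _ (Subgroup.subset_normalClosure hr) _

/-- The product of the labels around each vertex is trivial or conjugate into `R`. -/
def VertexCond (R : Set F) (σ : Perm D) (lab : D → F) : Prop :=
  ∀ x l, IsOrb σ x l → TrivialOrConj R ((x :: l).map lab).prod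

variable {R : Set F} {σ τ : Perm D} {lab : D → F} {x y : D} {l m : List D}

theorem TrivialOrConj.of_mem_orb (h : IsOrb σ x l) (hR : TrivialOrConj R ((x :: l).map lab).prod)
    (hy : y ∈ x :: l) (hm : IsOrb σ y m) : TrivialOrConj R ((y :: m).map lab).prod := by
  obtain ⟨s, t, hst, ho⟩ := h.rotate_to hy
  rw [hm.unique ho]
  rw [hst, List.map_append, List.prod_append] at hR
  have := hR.swap
  rwa [← List.prod_append, ← List.map_append, List.cons_append] at this

theorem VertexCond.of_cover
    (h : ∀ z, ∃ x l, IsOrb σ x l ∧ z ∈ x :: l ∧ TrivialOrConj R ((x :: l).map lab).prod) :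
    VertexCond R σ lab := by
  intro y m hm
  obtain ⟨x, l, h1, h2, h3⟩ := h y
  exact h3.of_mem_orb h1 h2 hm

variable [DecidableEq D] [Finite D]

/-- Some consecutive darts around a vertex whose labels have product `1` can be cut off to form a
vertex of their own. -/
theorem VertexCond.split (h : VertexCond R σ lab) (ho : IsOrb σ x (l ++ y :: m))
    (h1 : ((x :: l).map lab).prod = 1) : VertexCond R (swap x y * σ) lab := by
  refine .of_cover fun z => ?_
  by_cases hz : z ∈ x :: (l ++ y :: m)
  · rw [← List.cons_append, List.mem_append] at hz
    rcases hz with hz | hz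
    · exact ⟨x, l, ho.split.1, hz, Or.inl h1⟩
    · refine ⟨y, m, ho.split.2, hz, ?_⟩
      have := h _ _ ho
      rwa [← List.cons_append, List.map_append, List.prod_append, h1, one_mul] at this
  · obtain ⟨k, hk⟩ := exists_isOrb σ z
    refine ⟨z, k, hk.swap_mul ?_ ?_, by simp, h _ _ hk⟩
    · rw [hk.mem_iff]; intro h; exact hz (ho.mem_iff.2 h.symm)
    · rw [hk.mem_iff]; intro h
      exact hz (ho.mem_iff.2 ((ho.sameCycle (by simp)).trans h.symm))

theorem VertexCond.merge (h : VertexCond R σ lab)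
    (hx : IsOrb σ x l) (hy : IsOrb σ y m)
    (hv : ¬ σ.SameCycle x y)
    (h1 : TrivialOrConj R (((x :: l).map lab).prod * ((y :: m).map lab).prod)) :
    VertexCond R (swap x y * σ) lab := by
  have ho := hx.merge hy fun a ha hb => hv ((hx.sameCycle ha).trans (hy.sameCycle hb).symm)
  refine .of_cover fun z => ?_
  by_cases hz : z ∈ x :: (l ++ y :: m)
  · refine ⟨x, _, ho, hz, ?_⟩
    rwa [← List.cons_append, List.map_append, List.prod_append]
  · rw [← List.cons_append, List.mem_append, not_or, hx.mem_iff, hy.mem_iff] at hz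
    obtain ⟨k, hk⟩ := exists_isOrb σ z
    refine ⟨z, k, hk.swap_mul ?_ ?_, by simp, h _ _ hk⟩
    · rw [hk.mem_iff]; intro h; exact hz.1 h.symm
    · rw [hk.mem_iff]; intro h; exact hz.2 h.symm

theorem VertexCond.erase (h : VertexCond R σ lab) {d : D} (hτ' : τ d ≠ d) (hd : σ (τ d) = d)
    (hlab : lab (τ d) * lab d = 1) : VertexCond R σ (erase τ d lab) := by
  refine .of_cover fun z => ?_
  obtain ⟨k, hk⟩ := exists_isOrb σ (τ d)
  by_cases hz : z ∈ τ d :: k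
  · refine ⟨_, k, hk, hz, ?_⟩
    cases k with
    | nil =>
      have := hk.1
      simp [hd] at this
      exact absurd this.symm hτ'
    | cons b k =>
      have h1 := hk.1
      simp only [List.cons_append, List.isChain_cons_cons, hd] at h1
      obtain ⟨rfl, -⟩ := h1
      have h2 := h _ _ hk
      have h3 := hk.2
      simp only [List.nodup_cons, List.mem_cons, not_or] at h3
      have h4 : k.map (AtoricalConj.erase τ d lab) = k.map lab := List.map_congr_left fun a ha => by
        refine if_neg ?_
        rintro (rfl | rfl)
        · exact h3.2.1 ha
        · exact h3.1.2 ha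
      simp only [List.map_cons, List.prod_cons] at h2 ⊢
      rw [← mul_assoc, hlab, one_mul] at h2
      simpa [AtoricalConj.erase, h4] using h2
  · obtain ⟨j, hj⟩ := exists_isOrb σ z
    refine ⟨z, j, hj, by simp, ?_⟩
    have h4 : (z :: j).map (AtoricalConj.erase τ d lab) = (z :: j).map lab :=
      List.map_congr_left fun a ha => by
        refine if_neg ?_
        rw [hk.mem_iff] at hz
        have := hj.sameCycle ha
        rintro (rfl | rfl)
        · rw [← hd] at this
          exact hz (Perm.sameCycle_apply_right.1 this).symm
        · exact hz this.symm
    rw [h4]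
    exact h _ _ hj

end Vertex

/-! ### Conjugate cyclically reduced words -/

section Words

variable {A : Type*}

open FreeGroup

theorem isReduced_append_of {L M : List (A × Bool)} (hL : IsReduced L) (hM : IsReduced M)
    (h : ∀ a ∈ L.getLast?, ∀ b ∈ M.head?, a.1 = b.1 → a.2 = b.2) : IsReduced (L ++ M) :=
  List.IsChain.append hL hM h

theorem isCyclicallyReduced_of_isRotated {L M : List (A × Bool)} (h : L ~r M)
    (hL : IsCyclicallyReduced L) : IsCyclicallyReduced M := by
  have step : ∀ (a : A × Bool) (K : List (A × Bool)), IsCyclicallyReduced (a :: K) →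
      IsCyclicallyReduced (K ++ [a]) := by
    intro a K h
    cases K with
    | nil => simp
    | cons b K =>
      obtain ⟨h1, h2⟩ := h
      rw [List.cons_append, ← List.cons_append, isCyclicallyReduced_cons_append_iff]
      obtain ⟨h3, h4⟩ := List.isChain_cons_cons.1 h1
      refine ⟨isReduced_append_of h4 IsReduced.singleton ?_, h3⟩
      intro c hc d hd
      simp at hd
      subst hd
      exact h2 c (by simpa using hc) a (by simp)
  obtain ⟨n, rfl⟩ := h
  induction n generalizing L with
  | zero => simpa
  | succ n ih =>
    cases L with
    | nil => simp
    | cons a K =>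
      rw [List.rotate_cons_succ]
      exact ih (step a K hL)

/-- Conjugate cyclically reduced words are cyclic permutations of each other. -/
theorem isRotated_of_conj {L M : List (A × Bool)} (hL : IsCyclicallyReduced L)
    (hM : IsCyclicallyReduced M) {g : FreeGroup A} (h : mk L = g * mk M * g⁻¹) : L ~r M := by
  classical
  have key : ∀ (n : ℕ) (w M : List (A × Bool)), w.length = n → IsReduced w →
      IsCyclicallyReduced M → mk L = mk w * mk M * (mk w)⁻¹ → L ~r M := by
    intro n
    induction n with
    | zero =>
      intro w M hw _ hM h
      rw [List.length_eq_zero_iff] at hw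
      subst hw
      have h1 : mk L = mk M := by
        rw [h, ← one_eq_mk]; group
      have := congrArg toWord h1
      rw [toWord_mk, toWord_mk, hL.1.reduce_eq, hM.1.reduce_eq] at this
      rw [this]
    | succ n ih =>
      intro w M hw hwr hM h
      obtain ⟨w', a, rfl⟩ : ∃ w' a, w = w' ++ [a] := by
        rcases List.eq_nil_or_concat w with rfl | ⟨w', a, rfl⟩
        · simp at hw
        · exact ⟨w', a, by simp⟩
      have hw' : w'.length = n := by simpa using hw
      have hwr' : IsReduced w' := hwr.infix ⟨[], [a], by simp⟩
      have hinv : (mk [a])⁻¹ = mk [(a.1, !a.2)] := by simp [inv_mk, invRev]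
      by_cases hM0 : M = []
      · subst hM0
        have h1 : mk L = 1 := by rw [h, ← one_eq_mk]; group
        have := congrArg toWord h1
        rw [toWord_mk, hL.1.reduce_eq, toWord_one] at this
        rw [this]
      by_cases h1 : M.head? = some (a.1, !a.2)
      · obtain ⟨K, rfl⟩ : ∃ K, M = (a.1, !a.2) :: K := by
          cases M with
          | nil => simp at hM0
          | cons b K => simp at h1; subst h1; exact ⟨K, rfl⟩
        have hrot : (K ++ [(a.1, !a.2)]) ~r ((a.1, !a.2) :: K) := List.isRotated_concat _ _
        refine (ih w' (K ++ [(a.1, !a.2)]) hw' hwr'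
          (isCyclicallyReduced_of_isRotated hrot.symm hM) ?_).trans hrot
        rw [h, ← mul_mk, ← mul_mk, ← hinv,
          show mk ((a.1, !a.2) :: K) = (mk [a])⁻¹ * mk K by rw [hinv, mul_mk]; rfl]
        group
      by_cases h2 : M.getLast? = some a
      · obtain ⟨K, rfl⟩ : ∃ K, M = K ++ [a] := by
          rcases List.eq_nil_or_concat M with rfl | ⟨K, b, rfl⟩
          · simp at hM0
          · simp at h2; subst h2; exact ⟨K, by simp⟩
        have hrot : (a :: K) ~r (K ++ [a]) := (List.isRotated_concat _ _).symm
        refine (ih w' (a :: K) hw' hwr'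
          (isCyclicallyReduced_of_isRotated hrot.symm hM) ?_).trans hrot
        rw [h, ← mul_mk, ← mul_mk, show mk (a :: K) = mk [a] * mk K by rw [mul_mk]; rfl]
        group
      -- No cancellation: `w * M * w⁻¹` is reduced as written, so it is `L`, whose ends cancel.
      exfalso
      have hred : IsReduced ((w' ++ [a]) ++ M ++ invRev (w' ++ [a])) := by
        refine IsReduced.append_overlap (isReduced_append_of hwr hM.1 ?_)
          (isReduced_append_of hM.1 (isReduced_iff_reduce_eq.2 ?_) ?_) hM0
        · intro b hb c hc hbc
          simp at hb
          subst hb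
          by_contra hne
          apply h1
          rw [hc]
          congr 1
          ext
          · exact hbc.symm
          · cases hb1 : a.2 <;> cases hc1 : c.2 <;> simp_all
        · rw [reduce_invRev, hwr.reduce_eq]
        · intro b hb c hc hbc
          simp [invRev] at hc
          subst hc
          by_contra hne
          apply h2
          rw [hb]
          congr 1
          ext
          · exact hbc
          · cases hb1 : a.2 <;> cases hc1 : b.2 <;> simp_all
      have hLeq : L = (w' ++ [a]) ++ M ++ invRev (w' ++ [a]) := by
        have : mk L = mk ((w' ++ [a]) ++ M ++ invRev (w' ++ [a])) := by
          rw [h, inv_mk, mul_mk, mul_mk]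
        have := congrArg toWord this
        rwa [toWord_mk, toWord_mk, hL.1.reduce_eq, hred.reduce_eq] at this
      obtain ⟨b, u, hbu⟩ : ∃ b u, w' ++ [a] = b :: u := by
        cases w' with
        | nil => exact ⟨_, _, rfl⟩
        | cons b u => exact ⟨b, u ++ [a], rfl⟩
      rw [hbu] at hLeq
      have hlast : L = (b :: u ++ M ++ (u.map fun c => (c.1, !c.2)).reverse) ++ [(b.1, !b.2)] := by
        rw [hLeq]; simp [invRev]
      have := hL.2 (b.1, !b.2) (by rw [hlast, List.getLast?_concat]; rfl) b (by rw [hLeq]; simp) rfl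
      simp at this
  refine key _ g.toWord M rfl isReduced_toWord hM ?_
  rwa [mk_toWord]

end Words

/-! ### Restriction to a component -/

section Restrict

variable {D : Type*}

/-- If `D` is covered by two parts not related to each other, the classes are counted on each
part. -/
theorem classes_eq_add [Finite D] {S T : Type*} (r : Setoid D) (f : S → D) (g : T → D)
    (hfg : ∀ z, (∃ a, f a = z) ∨ ∃ b, g b = z) (hr : ∀ a b, ¬ r (f a) (g b)) :
    classes r = classes (r.comap f) + classes (r.comap g) := by
  have : Finite (Quotient (r.comap f)) := Finite.of_injective
    (Quotient.map' (s₂ := r) f fun _ _ h => h) fun a b => by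
      induction a using Quotient.inductionOn with | _ a => ?_
      induction b using Quotient.inductionOn with | _ b => ?_
      exact fun h => Quotient.sound (show r (f a) (f b) from Quotient.exact h)
  have : Finite (Quotient (r.comap g)) := Finite.of_injective
    (Quotient.map' (s₂ := r) g fun _ _ h => h) fun a b => by
      induction a using Quotient.inductionOn with | _ a => ?_
      induction b using Quotient.inductionOn with | _ b => ?_
      exact fun h => Quotient.sound (show r (g a) (g b) from Quotient.exact h)
  unfold classes
  rw [← Nat.card_sum]
  symm
  refine Nat.card_congr (Equiv.ofBijective (Sum.elim
    (Quotient.map' (s₁ := r.comap f) (s₂ := r) f fun _ _ h => h)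
    (Quotient.map' (s₁ := r.comap g) (s₂ := r) g fun _ _ h => h)) ⟨?_, ?_⟩)
  · rintro (a | a) (b | b) h
    all_goals
      induction a using Quotient.inductionOn with | _ a => ?_
      induction b using Quotient.inductionOn with | _ b => ?_
      have h' := Quotient.exact h
    · exact congrArg Sum.inl (Quotient.sound h')
    · exact absurd h' (hr _ _)
    · exact absurd (r.symm h') (hr _ _)
    · exact congrArg Sum.inr (Quotient.sound h')
  · intro q
    induction q using Quotient.inductionOn with | _ z => ?_
    rcases hfg z with ⟨a, rfl⟩ | ⟨b, rfl⟩
    · exact ⟨Sum.inl (Quotient.mk _ a), rfl⟩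
    · exact ⟨Sum.inr (Quotient.mk _ b), rfl⟩

theorem cyc_subtypePerm {f : Perm D} {p : D → Prop} (h : ∀ x, p (f x) ↔ p x) :
    cyc (f.subtypePerm h) = (cyc f).comap Subtype.val := by
  ext a b
  exact Perm.sameCycle_subtypePerm

/-- Related darts of a union of components are already related within it. -/
theorem rel_of_comps {σ τ : Perm D} {p : D → Prop} (hσ : ∀ x, p (σ x) ↔ p x)
    (hτ : ∀ x, p (τ x) ↔ p x) {s : Setoid {z // p z}}
    (h : comps (σ.subtypePerm hσ) (τ.subtypePerm hτ) ≤ s) {a b : D} (hab : comps σ τ a b)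
    (ha : p a) (hb : p b) : s ⟨a, ha⟩ ⟨b, hb⟩ := by
  let r : Setoid D :=
    { r := fun a b => (p a ↔ p b) ∧ ∀ ha hb, s ⟨a, ha⟩ ⟨b, hb⟩
      iseqv :=
        { refl := fun a => ⟨Iff.rfl, fun _ _ => s.refl _⟩
          symm := fun h => ⟨h.1.symm, fun ha hb => s.symm (h.2 hb ha)⟩
          trans := fun h h' => ⟨h.1.trans h'.1, fun ha hc =>
            s.trans (h.2 ha (h.1.1 ha)) (h'.2 (h.1.1 ha) hc)⟩ } }
  have hr : comps σ τ ≤ r := by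
    refine sup_le (cyc_le_iff.2 fun z => ⟨(hσ z).symm, fun h1 _ => ?_⟩)
      (cyc_le_iff.2 fun z => ⟨(hτ z).symm, fun h1 _ => ?_⟩)
    · exact h (comps_vertex (σ.subtypePerm hσ) (τ.subtypePerm hτ) ⟨z, h1⟩)
    · exact h (comps_edge (σ.subtypePerm hσ) (τ.subtypePerm hτ) ⟨z, h1⟩)
  exact (hr hab).2 ha hb

theorem IsOrb.map_val {f : Perm D} {p : D → Prop} (h : ∀ x, p (f x) ↔ p x) {x : {z // p z}}
    {l : List {z // p z}} (ho : IsOrb (f.subtypePerm h) x l) : IsOrb f x (l.map Subtype.val) := by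
  constructor
  · have : (x : D) :: l.map Subtype.val ++ [(x : D)] = (x :: l ++ [x]).map Subtype.val := by simp
    rw [this, List.isChain_map]
    exact ho.1.imp fun a b hab => by rw [← hab]; rfl
  · have := ho.2.map Subtype.val_injective
    simpa using this

/-- The Euler characteristic of a component of a map of genus at most one is nonnegative, because
the genus of the other components is nonnegative. -/
theorem euler_component_nonneg [Finite D] {σ τ : Perm D} (hτ : ∀ d, τ (τ d) = d)
    (hτ' : ∀ d, τ d ≠ d) (hg : genus2 σ τ ≤ 2) {p : D → Prop} (hσp : ∀ x, p (σ x) ↔ p x)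
    (hτp : ∀ x, p (τ x) ↔ p x) {d₀ : D} (hd₀ : p d₀) :
    0 ≤ (classes (cyc (σ.subtypePerm hσp)) : ℤ) - (Nat.card {z // p z} / 2 : ℕ) +
      classes (cyc (σ.subtypePerm hσp * τ.subtypePerm hτp)) := by
  have hsat : ∀ a b, comps σ τ a b → (p a ↔ p b) := by
    have : comps σ τ ≤ Setoid.ker p := sup_le (cyc_le_iff.2 fun z => propext (hσp z).symm)
      (cyc_le_iff.2 fun z => propext (hτp z).symm)
    exact fun a b hab => iff_of_eq (this hab)
  have hval : ∀ z, (∃ a : {z // p z}, a.1 = z) ∨ ∃ b : {z // ¬ p z}, b.1 = z := fun z =>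
    (em (p z)).imp (fun h => ⟨⟨z, h⟩, rfl⟩) fun h => ⟨⟨z, h⟩, rfl⟩
  have hcross : ∀ (a : {z // p z}) (b : {z // ¬ p z}), ¬ comps σ τ a b := fun a b h =>
    b.2 ((hsat _ _ h).1 a.2)
  have hσn : ∀ x, ¬ p (σ x) ↔ ¬ p x := fun x => not_congr (hσp x)
  have hτn : ∀ x, ¬ p (τ x) ↔ ¬ p x := fun x => not_congr (hτp x)
  have hφp : ∀ x, p ((σ * τ) x) ↔ p x := fun x => (hσp (τ x)).trans (hτp x)
  have hφn : ∀ x, ¬ p ((σ * τ) x) ↔ ¬ p x := fun x => not_congr (hφp x)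
  have e1 := classes_eq_add (cyc σ) _ _ hval fun a b h => hcross a b (comps_of_vertex h)
  have e2 := classes_eq_add (cyc τ) _ _ hval fun a b h =>
    hcross a b ((le_sup_right : _ ≤ comps σ τ) h)
  have e3 := classes_eq_add (cyc (σ * τ)) _ _ hval fun a b h => hcross a b (comps_of_face h)
  have e4 := classes_eq_add (comps σ τ) _ _ hval hcross
  rw [← cyc_subtypePerm hσp, ← cyc_subtypePerm (p := fun x => ¬ p x) hσn] at e1
  rw [← cyc_subtypePerm hτp, ← cyc_subtypePerm (p := fun x => ¬ p x) hτn] at e2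
  rw [← cyc_subtypePerm hφp, ← cyc_subtypePerm (p := fun x => ¬ p x) hφn] at e3
  have f1 : σ.subtypePerm hσp * τ.subtypePerm hτp = (σ * τ).subtypePerm hφp := rfl
  have f2 : σ.subtypePerm (p := fun x => ¬ p x) hσn * τ.subtypePerm (p := fun x => ¬ p x) hτn =
    (σ * τ).subtypePerm (p := fun x => ¬ p x) hφn := rfl
  have h1 := genus2_nonneg (τ := τ.subtypePerm (p := fun x => ¬ p x) hτn)
    (fun d => Subtype.ext (hτ d))
    (fun d h => hτ' d (congrArg Subtype.val h)) (σ.subtypePerm (p := fun x => ¬ p x) hσn)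
  have h2 : classes (comps (σ.subtypePerm (p := fun x => ¬ p x) hσn)
      (τ.subtypePerm (p := fun x => ¬ p x) hτn)) ≤
      classes ((comps σ τ).comap (Subtype.val : {z // ¬ p z} → D)) :=
    classes_anti fun a b hab => rel_of_comps (p := fun x => ¬ p x) hσn hτn le_rfl hab a.2 b.2
  have h3 : 0 < classes ((comps σ τ).comap (Subtype.val : {z // p z} → D)) :=
    Nat.card_pos_iff.2 ⟨⟨Quotient.mk _ ⟨d₀, hd₀⟩⟩, inferInstance⟩
  have h4 := card_eq_two_mul_classes (τ := τ.subtypePerm hτp) (fun d => Subtype.ext (hτ d))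
    (fun d h => hτ' d (congrArg Subtype.val h))
  unfold genus2 at hg h1
  rw [f2] at h1
  rw [f1, h4]
  omega

end Restrict

/-! ### Dipoles -/

section Dipole

open FreeGroup

variable {A : Type*}

theorem mk_flatMap {D : Type*} (f : D → List (A × Bool)) (l : List D) :
    FreeGroup.mk (l.flatMap f) = (l.map fun z => FreeGroup.mk (f z)).prod := by
  induction l with
  | nil => rfl
  | cons a l ih => rw [List.flatMap_cons, ← mul_mk, ih, List.map_cons, List.prod_cons]

theorem LabelledMap.vertexWord_eq {D : Type} [Finite D] (P : LabelledMap A D) {d : D} {l : List D}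
    (h : IsOrb P.next d l) : P.vertexWord d = (d :: l).flatMap P.label := by
  have h0 := isOrb_range P.next d
  rw [h.unique h0, ← map_range_eq_cons]
  have hpos : 0 < Function.minimalPeriod P.next d :=
    Function.minimalPeriod_pos_of_mem_periodicPts
      (Function.Injective.mem_periodicPts P.next.injective d)
  rw [Nat.sub_add_cancel hpos, List.flatMap_map]
  rfl

/-- A cyclic word without cancellation which is conjugate into the symmetrized set `R`
belongs to `R`. -/
theorem mk_mem_of_trivialOrConj {R : Set (FreeGroup A)} (hR : Symmetrized R)
    {L : List (A × Bool)} (hL : IsCyclicallyReduced L) (hne : L ≠ [])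
    (h : TrivialOrConj R (FreeGroup.mk L)) : FreeGroup.mk L ∈ R := by
  classical
  rcases h with h | ⟨g, r, hr, h⟩
  · have := congrArg toWord h
    rw [toWord_mk, hL.1.reduce_eq, toWord_one] at this
    exact absurd this hne
  · have hr' := hR r.toWord isReduced_toWord (by rwa [mk_toWord])
    refine hr'.2 L (Or.inl (isRotated_of_conj (g := g) hL hr'.1 ?_))
    rw [mk_toWord, h]

theorem eq_of_mk_mul_ne_one {a b : A × Bool}
    (h : FreeGroup.mk [a] * FreeGroup.mk [b] ≠ 1) (hab : a.1 = b.1) : a.2 = b.2 := by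
  by_contra hne
  apply h
  obtain ⟨a1, a2⟩ := a
  obtain ⟨b1, b2⟩ := b
  simp only at hab hne
  subst hab
  have : b2 = !a2 := by cases a2 <;> cases b2 <;> simp_all
  subst this
  have : (FreeGroup.mk [(a1, a2)])⁻¹ = FreeGroup.mk [(a1, !a2)] := by simp [inv_mk, invRev]
  rw [← this, mul_inv_cancel]

/-- A map of genus at most one in which no two successive labels around a vertex cancel, and which
has a nontrivial label, has a dipole: a component with a nontrivial label is a picture. -/
theorem exists_dipole {R : Set (FreeGroup A)} (hR : Symmetrized R) (hat : Atorical R)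
    {D : Type} [Finite D] {σ τ : Perm D} {lab : D → FreeGroup A} (hτ : ∀ d, τ (τ d) = d)
    (hτ' : ∀ d, τ d ≠ d) (hlab : ∀ d, lab (τ d) = (lab d)⁻¹)
    (hlet : ∀ d, lab d = 1 ∨ ∃ a, lab d = FreeGroup.mk [a]) (hv : VertexCond R σ lab)
    (hg : genus2 σ τ ≤ 2) (hfix : ∀ d, lab d = 1 → σ d = d)
    (hnc : ∀ d, lab d ≠ 1 → lab d * lab (σ d) ≠ 1) {d₀ : D} (hd₀ : lab d₀ ≠ 1) :
    ∃ d l m, lab d ≠ 1 ∧ ¬ σ.SameCycle d (τ d) ∧ IsOrb σ d l ∧ IsOrb σ (σ (τ d)) m ∧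
      ((d :: l).map lab).prod * ((σ (τ d) :: m).map lab).prod = 1 := by
  classical
  let p : D → Prop := comps σ τ d₀
  have hσp : ∀ x, p (σ x) ↔ p x := fun x =>
    ⟨fun h => (comps σ τ).trans h ((comps σ τ).symm (comps_vertex σ τ x)),
      fun h => (comps σ τ).trans h (comps_vertex σ τ x)⟩
  have hτp : ∀ x, p (τ x) ↔ p x := fun x =>
    ⟨fun h => (comps σ τ).trans h ((comps σ τ).symm (comps_edge σ τ x)),
      fun h => (comps σ τ).trans h (comps_edge σ τ x)⟩
  -- A trivial label occurs only at a univalent vertex, so that its component is a single edge.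
  have hnt : ∀ z, p z → lab z ≠ 1 := by
    have : comps σ τ ≤ Setoid.ker fun z => lab z = 1 := by
      refine sup_le (cyc_le_iff.2 fun z => propext ⟨fun h => ?_, fun h => ?_⟩)
        (cyc_le_iff.2 fun z => propext ?_)
      · rwa [hfix z h]
      · rwa [σ.injective (hfix _ h)] at h
      · show lab z = 1 ↔ lab (τ z) = 1
        rw [hlab, inv_eq_one]
    exact fun z hz h => hd₀ ((iff_of_eq (this hz)).2 h)
  choose a ha using fun z : {z // p z} => (hlet z).resolve_left (hnt z z.2)
  let P : LabelledMap A {z // p z} :=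
    { next := σ.subtypePerm hσp
      flip := τ.subtypePerm hτp
      flip_flip := fun d => Subtype.ext (hτ d)
      flip_ne := fun d h => hτ' d (congrArg Subtype.val h)
      label := fun z => (lab z).toWord
      label_flip := fun d => by
        show (lab (τ d)).toWord = _
        rw [hlab, toWord_inv] }
  have hword : ∀ z, (lab (z : {z // p z})).toWord = [a z] := fun z => by
    rw [ha, toWord_mk, IsReduced.singleton.reduce_eq]
  have hvw : ∀ {d : {z // p z}} {l}, IsOrb P.next d l → P.vertexWord d = (d :: l).map a := by
    intro d l ho
    rw [P.vertexWord_eq ho]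
    have : P.label = fun z => [a z] := funext hword
    rw [this, List.map_eq_flatMap]
  have hprod : ∀ {d : {z // p z}} {l}, IsOrb P.next d l → FreeGroup.mk (P.vertexWord d) =
      (((d : D) :: l.map Subtype.val).map lab).prod := by
    intro d l ho
    rw [P.vertexWord_eq ho, mk_flatMap, ← List.map_cons, List.map_map]
    congr 1
    refine List.map_congr_left fun z _ => ?_
    exact mk_toWord
  have hrel : ∀ z : {z // p z}, (a z).1 = (a (P.next z)).1 → (a z).2 = (a (P.next z)).2 := by
    intro z
    apply eq_of_mk_mul_ne_one
    rw [← ha, ← ha]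
    exact hnc _ (hnt z z.2)
  have hover : P.IsOver R := by
    intro d
    obtain ⟨l, ho⟩ := exists_isOrb P.next d
    have hcr : IsCyclicallyReduced (P.vertexWord d) := by
      obtain ⟨h1, h2⟩ := chain_append_singleton_iff.1 ho.1
      rw [hvw ho]
      refine ⟨?_, ?_⟩
      · unfold FreeGroup.IsReduced
        rw [List.isChain_map]
        refine h1.imp ?_
        rintro x y rfl
        exact hrel x
      · intro x hx y hy
        rw [List.getLast?_map, List.getLast?_eq_some_getLast (by simp)] at hx
        simp only [List.map_cons, List.head?_cons, Option.map_some, Option.mem_def,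
          Option.some.injEq] at hx hy
        subst hx hy
        have := hrel ((d :: l).getLast (by simp))
        rwa [h2] at this
    refine ⟨hcr.1, mk_mem_of_trivialOrConj hR hcr ?_ ?_⟩
    · rw [hvw ho]; simp
    · rw [hprod ho]
      exact hv _ _ (ho.map_val hσp)
  have hconn : P.Connected := by
    refine ⟨⟨⟨d₀, (comps σ τ).refl _⟩⟩, fun d d' => ?_⟩
    let H := Subgroup.closure ({P.next, P.flip} : Set (Perm {z // p z}))
    have hle : comps P.next P.flip ≤ MulAction.orbitRel H {z // p z} := by
      refine sup_le (cyc_le_iff.2 fun z => ?_) (cyc_le_iff.2 fun z => ?_)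
      · exact (MulAction.orbitRel H {z // p z}).symm
          ⟨⟨P.next, Subgroup.subset_closure (by simp)⟩, rfl⟩
      · exact (MulAction.orbitRel H {z // p z}).symm
          ⟨⟨P.flip, Subgroup.subset_closure (by simp)⟩, rfl⟩
    have hdd : comps σ τ d d' := (comps σ τ).trans ((comps σ τ).symm d.2) d'.2
    obtain ⟨g, hg⟩ := (MulAction.orbitRel H {z // p z}).symm (rel_of_comps hσp hτp hle hdd d.2 d'.2)
    exact ⟨g, g.2, hg⟩
  have htorus : P.OnTorus := euler_component_nonneg hτ hτ' hg hσp hτp ((comps σ τ).refl d₀)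
  obtain ⟨d, hd1, hd2⟩ := hat _ P hconn htorus hover
  obtain ⟨l, hl⟩ := exists_isOrb P.next d
  obtain ⟨m, hm⟩ := exists_isOrb P.next (P.next (P.flip d))
  refine ⟨d, _, _, hnt d d.2, fun h => hd1
    (show (σ.subtypePerm hσp).SameCycle d (P.flip d) from Perm.sameCycle_subtypePerm.2 h),
    hl.map_val hσp, hm.map_val hσp, ?_⟩
  rw [hprod hl, hprod hm, eq_inv_iff_mul_eq_one] at hd2
  exact hd2

end Dipole

/-! ### Reduction of maps of genus at most one -/

section Reduction

variable {D : Type*} {G : Type*} [Group G]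

/-- A map of genus zero is flat, and a map of genus at most one has cyclic holonomy. -/
def CyclicHolonomy (σ τ : Perm D) (lam : D → G) : Prop :=
  (genus2 σ τ ≤ 0 → HolonomyIn σ τ lam ⊥) ∧
    (genus2 σ τ ≤ 2 → ∃ c, HolonomyIn σ τ lam (Subgroup.zpowers c))

variable [Finite D] [DecidableEq D] {σ τ : Perm D} {lam : D → G} {x y : D}

/-- If `x` and `y` lie on different faces, these become one face after the swap, so that the gauge
there agrees at `x` and `y`. -/
theorem HolonomyIn.of_swap_of_not_face {K : Subgroup G} (hxy : comps σ τ x y)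
    (hf : ¬ (σ * τ).SameCycle x y) (h : HolonomyIn (swap x y * σ) τ lam K) :
    HolonomyIn σ τ lam K := by
  obtain ⟨p, hp, hK, hc⟩ := h
  exact .of_swap hxy hp (eq_of_not_face hp hf) hK hc

/-- Cutting a vertex in two: if this cuts a handle, the remaining map has genus zero and is flat; if
it does not, the holonomy is unchanged. -/
theorem CyclicHolonomy.of_split (hτ : ∀ d, τ (τ d) = d) (hτ' : ∀ d, τ d ≠ d) (hne : x ≠ y)
    (hv : σ.SameCycle x y) (h : CyclicHolonomy (swap x y * σ) τ lam) :
    CyclicHolonomy σ τ lam := by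
  have hle := genus2_swap_le (τ := τ) hne (Or.inl hv)
  by_cases hf : (σ * τ).SameCycle x y
  · by_cases hc : comps (swap x y * σ) τ x y
    · have h2 := genus2_swap_le_sub hne hv hf hc
      have h0 := genus2_nonneg hτ hτ' (swap x y * σ)
      exact ⟨fun hg => by omega, fun hg => HolonomyIn.of_split_bot hv (h.1 (by omega))⟩
    · refine ⟨fun hg => HolonomyIn.of_split_of_not_comps hv hc (h.1 (hle.trans hg)), fun hg => ?_⟩
      obtain ⟨c, hcc⟩ := h.2 (hle.trans hg)
      exact ⟨c, HolonomyIn.of_split_of_not_comps hv hc hcc⟩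
  · refine ⟨fun hg => .of_swap_of_not_face (comps_of_vertex hv) hf (h.1 (hle.trans hg)),
      fun hg => ?_⟩
    obtain ⟨c, hcc⟩ := h.2 (hle.trans hg)
    exact ⟨c, .of_swap_of_not_face (comps_of_vertex hv) hf hcc⟩

theorem CyclicHolonomy.of_merge {l m : List D} (hx : IsOrb σ x l) (hy : IsOrb σ y m)
    (hv : ¬ σ.SameCycle x y) (hf : (σ * τ).SameCycle x y) (h1 : ((x :: l).map lam).prod = 1)
    (h : CyclicHolonomy (swap x y * σ) τ lam) : CyclicHolonomy σ τ lam := by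
  have hne : x ≠ y := by rintro rfl; exact hv (Perm.SameCycle.refl _ _)
  have hle := genus2_swap_le hne (Or.inr hf)
  refine ⟨fun hg => .of_merge hx hy hv hf h1 (h.1 (hle.trans hg)), fun hg => ?_⟩
  obtain ⟨c, hcc⟩ := h.2 (hle.trans hg)
  exact ⟨c, .of_merge hx hy hv hf h1 hcc⟩

omit [Finite D] in
theorem CyclicHolonomy.of_erase {d : D} (hτ' : ∀ d, τ d ≠ d) (hd : σ (τ d) = d)
    (hlam : lam (τ d) * lam d = 1) (h : CyclicHolonomy σ τ (erase τ d lam)) :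
    CyclicHolonomy σ τ lam := by
  refine ⟨fun hg => .of_erase hτ' hd hlam (h.1 hg), fun hg => ?_⟩
  obtain ⟨c, hcc⟩ := h.2 hg
  exact ⟨c, .of_erase hτ' hd hlam hcc⟩

omit [Finite D] in
theorem map_erase {F : Type*} [Group F] (π : F →* G) (lab : D → F) (d : D) :
    (fun z => π (erase τ d lab z)) = erase τ d (fun z => π (lab z)) := by
  funext z
  unfold erase
  split_ifs <;> simp

/-- Contraction of the edge of `d`, which joins two different vertices: the vertices are joined
across the face beside the edge, and the edge becomes a loop bounding a disc, whose label can be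
made trivial. -/
theorem contract {F : Type*} [Group F] {R : Set F} (π : F →* G)
    (hπ : Subgroup.normalClosure R ≤ π.ker) {lab : D → F} (hτ' : ∀ d, τ d ≠ d)
    (hlab : ∀ d, lab (τ d) = (lab d)⁻¹) (hvc : VertexCond R σ lab) {d : D} {l m : List D}
    (hd : IsOrb σ d l) (hm : IsOrb σ (σ (τ d)) m) (hv : ¬ σ.SameCycle d (τ d))
    (h1 : TrivialOrConj R (((d :: l).map lab).prod * ((σ (τ d) :: m).map lab).prod)) :
    VertexCond R (swap d (σ (τ d)) * σ) (erase τ d lab) ∧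
      (CyclicHolonomy (swap d (σ (τ d)) * σ) τ (fun z => π (erase τ d lab z)) →
        CyclicHolonomy σ τ fun z => π (lab z)) := by
  have hv' : ¬ σ.SameCycle d (σ (τ d)) := fun h => hv (Perm.sameCycle_apply_right.1 h)
  have hdd : (swap d (σ (τ d)) * σ) (τ d) = d := by
    rw [Perm.mul_apply, swap_apply_right]
  have hinv : lab (τ d) * lab d = 1 := by rw [hlab, inv_mul_cancel]
  refine ⟨(hvc.merge hd hm hv' h1).erase (hτ' d) hdd hinv,
    fun h => ?_⟩
  rw [map_erase] at h
  refine CyclicHolonomy.of_merge hd hm hv' ?_ ?_ (h.of_erase hτ' hdd ?_)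
  · exact Perm.sameCycle_apply_right (f := σ * τ) (x := d) (y := d) |>.2 (Perm.SameCycle.refl _ _)
  · have := hπ (hvc _ _ hd).mem_normalClosure
    rwa [MonoidHom.mem_ker, map_list_prod, List.map_map] at this
  · rw [← map_mul, hinv, map_one]

end Reduction

section Letters

open FreeGroup

variable {A : Type*}

theorem mk_singleton_mul_self_ne_one {a : A × Bool} : FreeGroup.mk [a] * FreeGroup.mk [a] ≠ 1 := by
  classical
  intro h
  have h1 : IsReduced [a, a] := by simp
  have := congrArg toWord h
  rw [mul_mk, toWord_mk, List.singleton_append, h1.reduce_eq, toWord_one] at this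
  simp at this

/-- Maps of genus at most one, labelled by letters, with vertices labelled by relators of an
atorical presentation, have cyclic holonomy. The map is simplified by cutting off edge ends with a
trivial label, removing cancelling pairs of labels around a vertex and contracting dipoles; this
lowers the number of nontrivial labels, or else the number of edge ends at vertices that are not
univalent. -/
theorem cyclicHolonomy_of_letters {R : Set (FreeGroup A)} (hR : Symmetrized R) (hat : Atorical R)
    {G : Type*} [Group G] (π : FreeGroup A →* G) (hπ : Subgroup.normalClosure R ≤ π.ker)
    {D : Type} [Finite D] {σ τ : Perm D} {lab : D → FreeGroup A} (hτ : ∀ d, τ (τ d) = d)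
    (hτ' : ∀ d, τ d ≠ d) (hlab : ∀ d, lab (τ d) = (lab d)⁻¹)
    (hlet : ∀ d, lab d = 1 ∨ ∃ a, lab d = FreeGroup.mk [a]) (hv : VertexCond R σ lab) :
    CyclicHolonomy σ τ fun z => π (lab z) := by
  classical
  have := Fintype.ofFinite D
  induction hn : {d | lab d ≠ 1}.ncard using Nat.strong_induction_on generalizing σ lab with
  | _ n ihn =>
  subst hn
  have erase_lab : ∀ d z, erase τ d lab (τ z) = (erase τ d lab z)⁻¹ := by
    intro d z
    have : (τ z = d ∨ τ z = τ d) ↔ (z = d ∨ z = τ d) := by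
      rw [τ.injective.eq_iff, or_comm]
      refine or_congr_right ⟨?_, ?_⟩
      · rintro rfl; exact (hτ z).symm
      · rintro rfl; exact hτ d
    unfold erase
    rw [hlab]
    by_cases h : z = d ∨ z = τ d
    · rw [if_pos h, if_pos (this.2 h), inv_one]
    · rw [if_neg h, if_neg (fun h' => h (this.1 h'))]
  have erase_let : ∀ d z, erase τ d lab z = 1 ∨ ∃ a, erase τ d lab z = FreeGroup.mk [a] := by
    intro d z
    unfold erase
    split_ifs
    · exact Or.inl rfl
    · exact hlet z
  have erase_lt : ∀ d, lab d ≠ 1 → {z | erase τ d lab z ≠ 1}.ncard < {z | lab z ≠ 1}.ncard := by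
    intro d hd
    refine Set.ncard_lt_ncard (Set.ssubset_iff_exists.2 ⟨?_, d, hd, ?_⟩) (Set.toFinite _)
    · intro z hz h
      apply hz
      simp only [erase, h, ite_self]
    · simp [erase]
  -- A bivalent vertex with cancelling labels is contracted into a neighbouring vertex.
  have bivalent : ∀ (σ : Perm D) (d d' : D), VertexCond R σ lab → IsOrb σ d [d'] → d' ≠ τ d →
      lab d ≠ 1 → lab d * lab d' = 1 → CyclicHolonomy σ τ fun z => π (lab z) := by
    intro σ d d' hv ho hne hd h1
    have ho' : IsOrb σ d' [d] := ho.rotate (l := []) (m := [])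
    have hd' : lab d' ≠ 1 := by
      intro h; rw [h, mul_one] at h1; exact hd h1
    obtain ⟨m, hm⟩ := exists_isOrb σ (σ (τ d'))
    have hns : ¬ σ.SameCycle d' (τ d') := by
      rw [← ho'.mem_iff]
      simp only [List.mem_cons, List.not_mem_nil, or_false, not_or]
      refine ⟨hτ' d', fun h => hne ?_⟩
      rw [← h, hτ]
    have h2 : ((d' :: [d]).map lab).prod = 1 := by
      rw [mul_eq_one_iff_inv_eq] at h1
      simp [← h1]
    obtain ⟨hc1, hc2⟩ := contract π hπ hτ' hlab hv ho' hm hns (by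
      rw [h2, one_mul]; exact hv _ _ hm)
    exact hc2 (ihn _ (erase_lt d' hd') (erase_lab d') (erase_let d') hc1 rfl)
  induction hk : σ.support.card using Nat.strong_induction_on generalizing σ with
  | _ k ihk =>
  subst hk
  by_cases hs1 : ∃ f, lab f = 1 ∧ σ f ≠ f
  · -- An end of an edge with trivial label is detached from its vertex.
    obtain ⟨f, hf1, hf2⟩ := hs1
    have hlt := Perm.card_support_swap_mul hf2
    obtain ⟨l, hl⟩ := exists_isOrb σ f
    have hs : σ.SameCycle f (σ f) := Perm.sameCycle_apply_right.2 (Perm.SameCycle.refl _ _)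
    obtain ⟨t, rfl⟩ : ∃ t, l = σ f :: t := by
      have h := hl.1
      cases l with
      | nil => simp at h; exact absurd h hf2
      | cons b t =>
        simp only [List.cons_append, List.isChain_cons_cons] at h
        exact ⟨t, by rw [h.1]⟩
    exact CyclicHolonomy.of_split hτ hτ' (Ne.symm hf2) hs
      (ihk _ hlt (hv.split (l := []) hl (by simpa using hf1)) rfl)
  push Not at hs1
  by_cases hs2 : ∃ d, lab d ≠ 1 ∧ lab d * lab (σ d) = 1
  · obtain ⟨d, hd1, hd2⟩ := hs2
    by_cases hd3 : σ d = τ d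
    · -- The two cancelling ends belong to a loop bounding a disc.
      have hd4 : σ (τ (τ d)) = τ d := by rw [hτ, hd3]
      have hd5 : lab (τ (τ d)) * lab (τ d) = 1 := by rw [hτ, hlab, mul_inv_cancel]
      have hd6 : lab (τ d) ≠ 1 := by rwa [hlab, Ne, inv_eq_one]
      refine CyclicHolonomy.of_erase (d := τ d) hτ' hd4 ?_ ?_
      · rw [← _root_.map_mul, hd5, _root_.map_one]
      · rw [← map_erase]
        exact ihn _ (erase_lt _ hd6) (erase_lab _) (erase_let _) (hv.erase (hτ' _) hd4 hd5) rfl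
    · have hd4 : σ d ≠ d := by
        intro h
        rw [h] at hd2
        obtain ⟨a, ha⟩ := (hlet d).resolve_left hd1
        rw [ha] at hd2
        exact mk_singleton_mul_self_ne_one hd2
      obtain ⟨l, hl⟩ := exists_isOrb σ d
      have hch := hl.1
      match l, hl, hch with
      | [], hl, hch => simp at hch; exact absurd hch hd4
      | [b], hl, hch =>
        simp only [List.cons_append, List.isChain_cons_cons] at hch
        obtain ⟨rfl, -⟩ := hch
        exact bivalent σ d _ hv hl hd3 hd1 hd2
      | b :: c :: t, hl, hch =>
        -- The two cancelling ends are cut off, to form a bivalent vertex.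
        simp only [List.cons_append, List.isChain_cons_cons] at hch
        obtain ⟨rfl, -⟩ := hch
        have hl' : IsOrb σ d ([σ d] ++ c :: t) := hl
        have hdc : d ≠ c := by
          have := hl.2
          simp only [List.nodup_cons, List.mem_cons, not_or] at this
          exact this.1.2.1
        exact CyclicHolonomy.of_split hτ hτ' hdc (hl.sameCycle (by simp))
          (bivalent _ d _ (hv.split hl' (by simpa using hd2)) hl'.split.1 hd3 hd1 hd2)
  push Not at hs2
  by_cases hs3 : ∃ d, lab d ≠ 1
  · obtain ⟨d₀, hd₀⟩ := hs3
    by_cases hg : genus2 σ τ ≤ 2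
    · -- Nothing cancels, so there is a dipole, and its edge is contracted.
      obtain ⟨d, l, m, hd, hns, hl, hm, hp⟩ :=
        exists_dipole hR hat hτ hτ' hlab hlet hv hg hs1 hs2 hd₀
      obtain ⟨hc1, hc2⟩ := contract π hπ hτ' hlab hv hl hm hns (Or.inl hp)
      exact hc2 (ihn _ (erase_lt d hd) (erase_lab d) (erase_let d) hc1 rfl)
    · exact ⟨fun h => absurd (h.trans (by norm_num)) hg, fun h => absurd h hg⟩
  · push Not at hs3
    have hgau : ∀ d, gauged σ (fun z => π (lab z)) (fun _ => 1) d = 1 := fun d => by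
      simp [gauged, hs3 d]
    have : ∀ K : Subgroup G, HolonomyIn σ τ (fun z => π (lab z)) K := fun K =>
      ⟨fun _ => 1, fun _ => rfl, fun d => by rw [hgau]; exact one_mem _,
        fun a b ha => absurd (hgau a) ha⟩
    exact ⟨fun _ => this _, fun _ => ⟨1, this _⟩⟩

end Letters

/-! ### Adding an edge -/

section Sum

variable {D E : Type*}

theorem sumCongr_zpow (σ : Perm D) (ρ : Perm E) (i : ℤ) :
    (Perm.sumCongr σ ρ) ^ i = Perm.sumCongr (σ ^ i) (ρ ^ i) :=
  (map_zpow (Perm.sumCongrHom D E) (σ, ρ) i).symm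

theorem cyc_sumCongr_inl (σ : Perm D) (ρ : Perm E) :
    (cyc (Perm.sumCongr σ ρ)).comap Sum.inl = cyc σ := by
  ext a b
  show (∃ i : ℤ, _) ↔ (∃ i : ℤ, _)
  simp [sumCongr_zpow]

theorem cyc_sumCongr_inr (σ : Perm D) (ρ : Perm E) :
    (cyc (Perm.sumCongr σ ρ)).comap Sum.inr = cyc ρ := by
  ext a b
  show (∃ i : ℤ, _) ↔ (∃ i : ℤ, _)
  simp [sumCongr_zpow]

theorem not_comps_sumCongr {σ τ : Perm D} {ρ κ : Perm E} (a : D) (b : E) :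
    ¬ comps (Perm.sumCongr σ ρ) (Perm.sumCongr τ κ) (Sum.inl a) (Sum.inr b) := by
  have : comps (Perm.sumCongr σ ρ) (Perm.sumCongr τ κ) ≤ Setoid.ker Sum.isLeft :=
    sup_le (cyc_le_iff.2 (by rintro (z | z) <;> rfl)) (cyc_le_iff.2 (by rintro (z | z) <;> rfl))
  exact fun h => Bool.noConfusion (this h)

/-- The genus of a disjoint union. -/
theorem genus2_sumCongr_le [Finite D] [Finite E] (σ τ : Perm D) (ρ κ : Perm E) :
    genus2 (Perm.sumCongr σ ρ) (Perm.sumCongr τ κ) ≤ genus2 σ τ + genus2 ρ κ := by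
  have hval : ∀ z : D ⊕ E, (∃ a, Sum.inl a = z) ∨ ∃ b, Sum.inr b = z := by
    rintro (z | z) <;> simp
  have hcross := not_comps_sumCongr (σ := σ) (τ := τ) (ρ := ρ) (κ := κ)
  have e1 := classes_eq_add (cyc (Perm.sumCongr σ ρ)) _ _ hval fun a b h =>
    hcross a b (comps_of_vertex h)
  have e2 := classes_eq_add (cyc (Perm.sumCongr τ κ)) _ _ hval fun a b h =>
    hcross a b ((le_sup_right : _ ≤ comps _ _) h)
  have e3 := classes_eq_add (cyc (Perm.sumCongr σ ρ * Perm.sumCongr τ κ)) _ _ hval fun a b h =>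
    hcross a b (comps_of_face h)
  have e4 := classes_eq_add _ _ _ hval hcross
  rw [cyc_sumCongr_inl, cyc_sumCongr_inr] at e1 e2
  rw [Perm.sumCongr_mul, cyc_sumCongr_inl, cyc_sumCongr_inr] at e3
  have h1 : classes ((comps (Perm.sumCongr σ ρ) (Perm.sumCongr τ κ)).comap Sum.inl) ≤
      classes (comps σ τ) := classes_anti <|
    sup_le (cyc_le_iff.2 fun z => comps_vertex (Perm.sumCongr σ ρ) (Perm.sumCongr τ κ) (Sum.inl z))
      (cyc_le_iff.2 fun z => comps_edge (Perm.sumCongr σ ρ) (Perm.sumCongr τ κ) (Sum.inl z))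
  have h2 : classes ((comps (Perm.sumCongr σ ρ) (Perm.sumCongr τ κ)).comap Sum.inr) ≤
      classes (comps ρ κ) := classes_anti <|
    sup_le (cyc_le_iff.2 fun z => comps_vertex (Perm.sumCongr σ ρ) (Perm.sumCongr τ κ) (Sum.inr z))
      (cyc_le_iff.2 fun z => comps_edge (Perm.sumCongr σ ρ) (Perm.sumCongr τ κ) (Sum.inr z))
  unfold genus2
  rw [Perm.sumCongr_mul]
  omega

/-- The vertex permutation after a new edge, with two univalent vertices, has been added. -/
abbrev addVertices (σ : Perm D) : Perm (D ⊕ Bool) := Perm.sumCongr σ 1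

/-- The edge involution after a new edge has been added. -/
abbrev addEdge (τ : Perm D) : Perm (D ⊕ Bool) := Perm.sumCongr τ Equiv.boolNot

theorem genus2_add_le [Finite D] (σ τ : Perm D) :
    genus2 (addVertices σ) (addEdge τ) ≤ genus2 σ τ := by
  have h := genus2_sumCongr_le σ τ (1 : Perm Bool) Equiv.boolNot
  rwa [genus2_one (by decide) (by decide), add_zero] at h

theorem addEdge_addEdge {τ : Perm D} (hτ : ∀ d, τ (τ d) = d) (z : D ⊕ Bool) :
    addEdge τ (addEdge τ z) = z := by
  rcases z with z | z
  · exact congrArg Sum.inl (hτ z)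
  · exact congrArg Sum.inr (Bool.not_not z)

theorem addEdge_ne {τ : Perm D} (hτ' : ∀ d, τ d ≠ d) (z : D ⊕ Bool) : addEdge τ z ≠ z := by
  rcases z with z | z
  · exact fun h => hτ' z (Sum.inl_injective h)
  · exact fun h => Bool.not_ne_self z (Sum.inr_injective h)

theorem IsOrb.inl {σ : Perm D} {x : D} {l : List D} (h : IsOrb σ x l) :
    IsOrb (addVertices σ) (Sum.inl x) (l.map Sum.inl) := by
  constructor
  · have : (Sum.inl x : D ⊕ Bool) :: l.map Sum.inl ++ [Sum.inl x] =
        (x :: l ++ [x]).map Sum.inl := by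
      simp
    rw [this, List.isChain_map]
    exact h.1.imp fun a b hab => congrArg Sum.inl hab
  · have := h.2.map (Sum.inl_injective (β := Bool))
    simpa using this

theorem isOrb_of_fixed {f : Perm D} {x : D} (h : f x = x) : IsOrb f x [] := by
  constructor
  · simpa using h
  · simp

end Sum

section WeakHolonomy

variable {D : Type*} {G : Type*} [Group G]

/-- After a suitable change of gauge, constant on faces, all labels are powers of one element. -/
def GaugeCyclic (σ τ : Perm D) (lam : D → G) : Prop :=
  ∃ (c : G) (p : D → G), (∀ d, p (σ (τ d)) = p d) ∧ ∀ d, gauged σ lam p d ∈ Subgroup.zpowers c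

/-- Attaching a pendant edge does not change the holonomy. -/
theorem GaugeCyclic.of_pendant [Finite D] [DecidableEq D] {σ τ : Perm D}
    {lam : D ⊕ Bool → G} {x : D}
    (h : GaugeCyclic (swap (Sum.inl x) (Sum.inr true) * addVertices σ) (addEdge τ) lam) :
    GaugeCyclic σ τ (fun z => lam (Sum.inl z)) := by
  obtain ⟨c, p, hp, hc⟩ := h
  have hxy : p (Sum.inl x) = p (Sum.inr true) :=
    eq_of_not_face hp fun h => not_comps_sumCongr _ _ (comps_of_face h)
  refine ⟨c, fun z => p (Sum.inl z), fun d => face_const_of_swap hp hxy (Sum.inl d), fun d => ?_⟩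
  have := hc (Sum.inl d)
  rwa [gauged_swap hxy] at this

end WeakHolonomy

section Insert

variable {D : Type*} {F : Type*} [Group F] [Finite D] [DecidableEq D]
  {R : Set F} {f : Perm D} {lab lab' : D → F} {a e : D}

/-- Inserting the isolated dart `e` before `a`, with new labels on the vertex of `a`. -/
theorem VertexCond.of_insert (h : VertexCond R f lab) (he : f e = e)
    (hlab : ∀ z, ¬ f.SameCycle a z → z ≠ e → lab' z = lab z)
    (hae : a ≠ e)
    (h1 : ∀ l, IsOrb f a l → TrivialOrConj R (lab' e * ((a :: l).map lab').prod)) :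
    VertexCond R (swap a e * f) lab' := by
  obtain ⟨l, hl⟩ := exists_isOrb f a
  have hfe : ∀ z, f.SameCycle e z → z = e := fun z hz => (hz.eq_of_left he).symm
  rw [swap_comm]
  have ho := (isOrb_of_fixed he).merge hl (by
    intro z hz hz'
    rw [List.mem_singleton] at hz
    subst hz
    exact hae (hfe _ (hl.sameCycle hz').symm))
  refine .of_cover fun z => ?_
  by_cases hz : z ∈ e :: ([] ++ a :: l)
  · refine ⟨e, _, ho, hz, ?_⟩
    rw [List.nil_append, List.map_cons, List.prod_cons]
    exact h1 l hl
  · obtain ⟨k, hk⟩ := exists_isOrb f z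
    rw [List.nil_append, List.mem_cons, not_or, hl.mem_iff] at hz
    have hke : e ∉ z :: k := fun h => hz.1 (hfe _ (hk.sameCycle h).symm)
    have hka : a ∉ z :: k := fun h => hz.2 (hk.sameCycle h).symm
    refine ⟨z, k, hk.swap_mul hke hka, by simp, ?_⟩
    have : (z :: k).map lab' = (z :: k).map lab := List.map_congr_left fun b hb => by
      refine hlab b (fun h => hz.2 (h.trans (hk.sameCycle hb).symm)) ?_
      rintro rfl; exact hke hb
    rw [this]
    exact h _ _ hk

/-- Inserting a dart before the dart `a`, the label of `a` being factored accordingly. -/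
theorem VertexCond.insert_before (h : VertexCond R f lab) (he : f e = e) (hae : a ≠ e)
    (hlab : ∀ z, z ≠ a → z ≠ e → lab' z = lab z) (hm : lab' e * lab' a = lab a) :
    VertexCond R (swap a e * f) lab' := by
  refine h.of_insert he (fun z hz => hlab z (by rintro rfl; exact hz (Perm.SameCycle.refl _ _))) hae
    fun l hl => ?_
  have := h _ _ hl
  have hl' : l.map lab' = l.map lab := List.map_congr_left fun b hb => by
    refine hlab b ?_ ?_
    · rintro rfl; exact (List.nodup_cons.1 hl.2).1 hb
    · rintro rfl
      exact hae ((hl.sameCycle (List.mem_cons_of_mem _ hb)).eq_of_right he)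
  rw [List.map_cons, List.prod_cons] at this ⊢
  rwa [hl', ← mul_assoc, hm]

/-- Inserting a dart after the dart `a`, the label of `a` being factored accordingly. -/
theorem VertexCond.insert_after (h : VertexCond R f lab) (he : f e = e) (hae : a ≠ e)
    (hlab : ∀ z, z ≠ a → z ≠ e → lab' z = lab z) (hm : lab' a * lab' e = lab a) :
    VertexCond R (swap (f a) e * f) lab' := by
  have hs : f.SameCycle (f a) a := Perm.sameCycle_apply_left.2 (Perm.SameCycle.refl _ _)
  refine h.of_insert he (fun z hz => hlab z (by rintro rfl; exact hz hs))
    (fun h => hae (f.injective (h.trans he.symm))) fun l hl => ?_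
  have := h _ _ hl
  have hlast : (f a :: l).getLast (by simp) = a :=
    f.injective (chain_append_singleton_iff.1 hl.1).2
  have hdec := List.dropLast_append_getLast (l := f a :: l) (by simp)
  rw [hlast] at hdec
  have hnd := hl.2
  have hne : e ∉ f a :: l := fun h => hae ((hs.symm.trans (hl.sameCycle h)).eq_of_right he)
  rw [← hdec] at this hnd hne ⊢
  have hl' : (f a :: l).dropLast.map lab' = (f a :: l).dropLast.map lab :=
    List.map_congr_left fun b hb => by
      refine hlab b ?_ ?_
      · rintro rfl
        rw [List.nodup_append'] at hnd
        exact hnd.2.2 hb (by simp)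
      · rintro rfl
        exact hne (List.mem_append_left _ hb)
  rw [List.map_append, List.prod_append, List.map_singleton, List.prod_singleton] at this ⊢
  rw [hl']
  refine TrivialOrConj.swap ?_
  rwa [mul_assoc, hm]

end Insert

section Refine

variable {D : Type} {F : Type*} [Group F]

/-- The labels after the edge of `d` has been replaced by two parallel edges, labelled `u`
and `v`. -/
def refineLab [DecidableEq D] (τ : Perm D) (d : D) (u v : F) (lab : D → F) : D ⊕ Bool → F
  | Sum.inl z => if z = d then u else if z = τ d then u⁻¹ else lab z
  | Sum.inr true => v
  | Sum.inr false => v⁻¹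

/-- The vertex permutation after a dart has been inserted after `d` and a dart before `τ d`. -/
def refinePerm [DecidableEq D] (σ τ : Perm D) (d : D) : Perm (D ⊕ Bool) :=
  swap (Sum.inl (τ d)) (Sum.inr false) * (swap (Sum.inl (σ d)) (Sum.inr true) * addVertices σ)

variable [DecidableEq D] {σ τ : Perm D} {d : D} {u v : F} {lab : D → F}

theorem refineLab_addEdge (hτ : ∀ d, τ (τ d) = d) (hτ' : ∀ d, τ d ≠ d)
    (hlab : ∀ d, lab (τ d) = (lab d)⁻¹) (z : D ⊕ Bool) :
    refineLab τ d u v lab (addEdge τ z) = (refineLab τ d u v lab z)⁻¹ := by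
  rcases z with z | z
  · show ite _ _ _ = (ite _ _ _)⁻¹
    by_cases h1 : z = d
    · subst h1; rw [if_neg (hτ' z), if_pos rfl, if_pos rfl]
    · by_cases h2 : z = τ d
      · subst h2; rw [if_pos (hτ d), if_neg h1, if_pos rfl, inv_inv]
      · rw [if_neg fun h => h2 (by rw [← h, hτ]), if_neg fun h => h1 (τ.injective h), if_neg h1,
          if_neg h2, hlab]
  · cases z
    · exact (inv_inv v).symm
    · rfl

/-- One end of a pendant edge is attached first; its other end then lies on the same face as
`τ d`. -/
theorem genus2_refine_le [Finite D] (hτ : ∀ d, τ (τ d) = d) :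
    genus2 (refinePerm σ τ d) (addEdge τ) ≤ genus2 σ τ := by
  have h1 : genus2 (swap (Sum.inl (σ d)) (Sum.inr true) * addVertices σ) (addEdge τ) ≤
      genus2 σ τ :=
    (genus2_swap_le_of_not_comps (not_comps_sumCongr _ _)).trans (genus2_add_le σ τ)
  refine (genus2_swap_le (by simp) (Or.inr ?_)).trans h1
  set φ := swap (Sum.inl (σ d)) (Sum.inr true) * addVertices σ * addEdge τ with hφ
  have e1 : φ (Sum.inl (τ d)) = Sum.inr true := by
    simp [hφ, hτ]
  have e2 : φ (Sum.inr true) = Sum.inr false := by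
    simp only [hφ, Perm.mul_apply]
    show swap _ _ (Sum.inr false) = _
    rw [swap_apply_of_ne_of_ne (by simp) (by simp)]
  rw [← e2, ← e1]
  exact Perm.sameCycle_apply_right.2 (Perm.sameCycle_apply_right.2 (Perm.SameCycle.refl _ _))

theorem VertexCond.refine [Finite D] {R : Set F} (hτ' : ∀ d, τ d ≠ d)
    (hlab : ∀ d, lab (τ d) = (lab d)⁻¹) (huv : lab d = u * v) (h : VertexCond R σ lab) :
    VertexCond R (refinePerm σ τ d) (refineLab τ d u v lab) := by
  let lab0 : D ⊕ Bool → F := Sum.elim lab fun _ => 1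
  have h0 : VertexCond R (addVertices σ) lab0 := by
    refine .of_cover ?_
    rintro (z | z)
    · obtain ⟨l, hl⟩ := exists_isOrb σ z
      refine ⟨_, _, hl.inl, by simp, ?_⟩
      have : (Sum.inl z :: l.map Sum.inl).map lab0 = (z :: l).map lab := by
        simp [lab0, Function.comp_def]
      rw [this]
      exact h _ _ hl
    · exact ⟨_, _, isOrb_of_fixed (f := addVertices σ) (x := Sum.inr z) rfl, by simp,
        Or.inl (by simp [lab0])⟩
  let lab1 : D ⊕ Bool → F := fun z =>
    if z = Sum.inl d then u else if z = Sum.inr true then v else lab0 z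
  have h1 : VertexCond R (swap (addVertices σ (Sum.inl d)) (Sum.inr true) * addVertices σ) lab1 :=
    h0.insert_after rfl (by simp) (fun z hz hz' => by simp [lab1, hz, hz'])
      (by simp [lab1, lab0, huv])
  refine VertexCond.insert_before (lab := lab1) h1 ?_ (by simp) ?_ ?_
  · rw [Perm.mul_apply]
    show swap _ _ (Sum.inr false) = _
    rw [swap_apply_of_ne_of_ne (by simp) (by simp)]
  · rintro (z | z) hz hz'
    · have : z ≠ τ d := fun h => hz (by rw [h])
      simp [refineLab, lab1, lab0, this]
    · cases z
      · exact absurd rfl hz'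
      · simp [refineLab, lab1]
  · simp [refineLab, lab1, lab0, hτ', hlab, huv]

/-- Two parallel edges have, together, the holonomy of the edge they replace. -/
theorem GaugeCyclic.of_refine {G : Type*} [Group G] (π : F →* G) (hτ : ∀ d, τ (τ d) = d)
    (hτ' : ∀ d, τ d ≠ d) (hlab : ∀ d, lab (τ d) = (lab d)⁻¹) (huv : lab d = u * v)
    (h : GaugeCyclic (refinePerm σ τ d) (addEdge τ) fun z => π (refineLab τ d u v lab z)) :
    GaugeCyclic σ τ fun z => π (lab z) := by
  obtain ⟨c, p, hp, hc⟩ := h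
  let hd : D → D ⊕ Bool := fun z => if z = τ d then Sum.inr false else Sum.inl z
  have s1 : refinePerm σ τ d (Sum.inl d) = Sum.inr true := by
    simp only [refinePerm, Perm.mul_apply]
    show swap _ _ (swap _ _ (Sum.inl (σ d))) = _
    rw [swap_apply_left, swap_apply_of_ne_of_ne (by simp) (by simp)]
  have s0 : ∀ z, swap (Sum.inl (τ d)) (Sum.inr false) (Sum.inl z) = hd z := by
    intro z
    by_cases hz : z = τ d
    · simp [hd, hz]
    · rw [swap_apply_of_ne_of_ne (by simpa using hz) (by simp)]
      simp [hd, hz]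
  have s2 : refinePerm σ τ d (Sum.inr true) = hd (σ d) := by
    simp only [refinePerm, Perm.mul_apply]
    show swap _ _ (swap _ _ (Sum.inr true)) = _
    rw [swap_apply_right, s0]
  have s3 : refinePerm σ τ d (Sum.inr false) = Sum.inl (τ d) := by
    simp only [refinePerm, Perm.mul_apply]
    show swap _ _ (swap _ _ (Sum.inr false)) = _
    rw [swap_apply_of_ne_of_ne (a := Sum.inl (σ d)) (by simp) (by simp), swap_apply_right]
  have s4 : ∀ z, z ≠ d → refinePerm σ τ d (Sum.inl z) = hd (σ z) := by
    intro z hz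
    simp only [refinePerm, Perm.mul_apply]
    show swap _ _ (swap _ _ (Sum.inl (σ z))) = _
    rw [swap_apply_of_ne_of_ne (a := Sum.inl (σ d)) (by simpa using hz) (by simp), s0]
  have h1 : hd (τ d) = Sum.inr false := if_pos rfl
  have h2 : ∀ z, z ≠ τ d → hd z = Sum.inl z := fun z hz => if_neg hz
  refine ⟨c, fun z => p (hd z), fun z => ?_, fun z => ?_⟩
  · show p (hd (σ (τ z))) = p (hd z)
    by_cases hz : z = τ d
    · subst hz
      rw [hτ, h1, ← hp (Sum.inr false)]
      show _ = p (refinePerm σ τ d (Sum.inr true))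
      rw [s2]
    · rw [h2 z hz, ← hp (Sum.inl z)]
      show _ = p (refinePerm σ τ d (Sum.inl (τ z)))
      rw [s4 _ fun h => hz (by rw [← h, hτ])]
  · by_cases hzd : z = d
    · subst hzd
      have e1 := hc (Sum.inl z)
      have e2 := hc (Sum.inr true)
      unfold gauged at e1 e2 ⊢
      rw [s1] at e1
      rw [s2] at e2
      have := mul_mem e1 e2
      dsimp only
      rw [h2 z (Ne.symm (hτ' z)), huv, _root_.map_mul]
      simp only [refineLab, if_true] at this
      convert this using 1
      group
    · by_cases hz : z = τ d
      · subst hz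
        have e1 := hc (Sum.inr false)
        have e2 := hc (Sum.inl (τ d))
        unfold gauged at e1 e2 ⊢
        rw [s3] at e1
        rw [s4 _ hzd] at e2
        have := mul_mem e1 e2
        dsimp only
        rw [h1, hlab, huv, mul_inv_rev, _root_.map_mul]
        simp only [refineLab, if_neg (hτ' d), if_true] at this
        convert this using 1
        group
      · have e1 := hc (Sum.inl z)
        unfold gauged at e1 ⊢
        rw [s4 _ hzd] at e1
        dsimp only
        rw [h2 z hz]
        simpa only [refineLab, if_neg hzd, if_neg hz] using e1

end Refine

/-! ### Commuting elements of an atorical group -/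

section Commuting

open FreeGroup

variable {A : Type*}

/-- Maps of genus at most one with vertices labelled by relators of an atorical presentation have
cyclic holonomy. An edge labelled by a word of length at least two is replaced by two parallel
edges, labelled by the first letter and by the rest, until all labels are letters. -/
theorem gaugeCyclic_of_vertexCond {R : Set (FreeGroup A)} (hR : Symmetrized R) (hat : Atorical R)
    {G : Type*} [Group G] (π : FreeGroup A →* G) (hπ : Subgroup.normalClosure R ≤ π.ker)
    {D : Type} [Finite D] {σ τ : Perm D} {lab : D → FreeGroup A} (hτ : ∀ d, τ (τ d) = d)
    (hτ' : ∀ d, τ d ≠ d) (hlab : ∀ d, lab (τ d) = (lab d)⁻¹)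
    (hv : VertexCond R σ lab) (hg : genus2 σ τ ≤ 2) : GaugeCyclic σ τ fun z => π (lab z) := by
  classical
  have key : ∀ (n : ℕ) (D : Type) [Fintype D] (σ τ : Perm D) (lab : D → FreeGroup A),
      (∀ d, τ (τ d) = d) → (∀ d, τ d ≠ d) → (∀ d, lab (τ d) = (lab d)⁻¹) → VertexCond R σ lab →
      genus2 σ τ ≤ 2 → ∑ z, ((lab z).norm - 1) = n → GaugeCyclic σ τ fun z => π (lab z) := by
    intro n
    induction n using Nat.strong_induction_on with
    | _ n ih =>
    intro D _ σ τ lab hτ hτ' hlab hv hg hn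
    by_cases hlet : ∀ d, lab d = 1 ∨ ∃ a, lab d = FreeGroup.mk [a]
    · obtain ⟨c, p, hp, hc, -⟩ :=
        (cyclicHolonomy_of_letters hR hat π hπ hτ hτ' hlab hlet hv).2 hg
      exact ⟨c, p, hp, hc⟩
    push Not at hlet
    obtain ⟨d, hd1, hd2⟩ := hlet
    obtain ⟨a, b, t, hw⟩ : ∃ a b t, (lab d).toWord = a :: b :: t := by
      match h : (lab d).toWord with
      | [] => exact absurd (toWord_eq_nil_iff.1 h) hd1
      | [a] => exact absurd (by rw [← h, mk_toWord]) (hd2 a)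
      | a :: b :: t => exact ⟨a, b, t, rfl⟩
    have hred : IsReduced (b :: t) := by
      have : IsReduced (lab d).toWord := isReduced_toWord
      rw [hw] at this
      exact this.infix ⟨[a], [], by simp⟩
    have huv : lab d = FreeGroup.mk [a] * FreeGroup.mk (b :: t) := by
      rw [mul_mk, List.singleton_append, ← hw, mk_toWord]
    have hu : (FreeGroup.mk [a]).norm = 1 := by
      rw [FreeGroup.norm, toWord_mk, IsReduced.singleton.reduce_eq]; rfl
    have hvn : (FreeGroup.mk (b :: t)).norm = t.length + 1 := by
      rw [FreeGroup.norm, toWord_mk, hred.reduce_eq]; rfl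
    have hdn : (lab d).norm = t.length + 2 := by
      rw [FreeGroup.norm, hw]; rfl
    have hτdn : (lab (τ d)).norm = t.length + 2 := by
      rw [hlab, norm_inv_eq, hdn]
    refine GaugeCyclic.of_refine π hτ hτ' hlab huv (ih _ ?_ (D ⊕ Bool) _ _ _
      (addEdge_addEdge hτ) (addEdge_ne hτ') (refineLab_addEdge hτ hτ' hlab)
      (hv.refine hτ' hlab huv) ((genus2_refine_le hτ).trans hg) rfl)
    rw [← hn, Fintype.sum_sum_type]
    have h1 : ∀ z, (lab z).norm - 1 =
        ((refineLab τ d (FreeGroup.mk [a]) (FreeGroup.mk (b :: t)) lab (Sum.inl z)).norm - 1) +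
          ((if z = d then t.length + 1 else 0) + if z = τ d then t.length + 1 else 0) := by
      intro z
      by_cases h1 : z = d
      · subst h1
        simp [refineLab, hu, hdn, (hτ' z).symm]
      · by_cases h2 : z = τ d
        · subst h2
          simp only [refineLab, if_neg (hτ' d), if_true, norm_inv_eq, hu, hτdn]
          omega
        · simp [refineLab, h1, h2]
    rw [Finset.sum_congr rfl fun z _ => h1 z, Finset.sum_add_distrib, Finset.sum_add_distrib,
      Finset.sum_ite_eq', Finset.sum_ite_eq']
    simp only [Finset.mem_univ, if_true, Fintype.sum_bool, refineLab, norm_inv_eq, hvn]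
    omega
  have := Fintype.ofFinite D
  exact key _ D σ τ lab hτ hτ' hlab hv hg rfl

/-- A version of `gaugeCyclic_of_vertexCond` with one exceptional vertex, whose product becomes
trivial after multiplication with relators. Each relator labels a pendant edge attached to the
exceptional vertex, whose other end is a vertex labelled by the inverse relator. -/
theorem gaugeCyclic_of_list {R : Set (FreeGroup A)} (hR : Symmetrized R) (hat : Atorical R)
    {G : Type*} [Group G] (π : FreeGroup A →* G) (hπ : Subgroup.normalClosure R ≤ π.ker)
    (L : List (FreeGroup A)) (hL : ∀ w ∈ L, TrivialOrConj R w⁻¹) :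
    ∀ {D : Type} [Finite D] {σ τ : Perm D} {lab : D → FreeGroup A} {x : D} {l : List D}
    (_ : ∀ d, τ (τ d) = d) (_ : ∀ d, τ d ≠ d) (_ : ∀ d, lab (τ d) = (lab d)⁻¹)
    (_ : IsOrb σ x l)
    (_ : ∀ z k, IsOrb σ z k → ¬ σ.SameCycle z x → TrivialOrConj R ((z :: k).map lab).prod)
    (_ : genus2 σ τ ≤ 2) (_ : ((x :: l).map lab).prod * L.prod = 1),
    GaugeCyclic σ τ fun z => π (lab z) := by
  classical
  induction L with
  | nil =>
    intro D _ σ τ lab x l hτ hτ' hlab hx hv hg h1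
    refine gaugeCyclic_of_vertexCond hR hat π hπ hτ hτ' hlab (fun z k hk => ?_) hg
    by_cases hz : σ.SameCycle z x
    · exact TrivialOrConj.of_mem_orb hx (Or.inl (by simpa using h1)) (hx.mem_iff.2 hz.symm) hk
    · exact hv z k hk hz
  | cons w L ih =>
    intro D _ σ τ lab x l hτ hτ' hlab hx hv hg h1
    let lab' : D ⊕ Bool → FreeGroup A := Sum.elim lab fun b => if b then w else w⁻¹
    have hns : ¬ (addVertices σ).SameCycle (Sum.inl x) (Sum.inr true) := fun h =>
      not_comps_sumCongr (τ := τ) (κ := 1) _ _ (comps_of_vertex h)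
    have hb : ∀ b, IsOrb (addVertices σ) (Sum.inr b) [] := fun b => isOrb_of_fixed rfl
    have horb := hx.inl.merge (hb true) fun a ha hb' =>
      hns ((hx.inl.sameCycle ha).trans ((hb true).sameCycle hb').symm)
    refine GaugeCyclic.of_pendant (x := x) (lam := fun z => π (lab' z))
      (ih (fun w hw => hL w (List.mem_cons_of_mem _ hw)) (lab := lab') (addEdge_addEdge hτ)
        (addEdge_ne hτ') ?_ horb ?_
        (((genus2_swap_le_of_not_comps (not_comps_sumCongr _ _)).trans
          (genus2_add_le σ τ)).trans hg)
        ?_)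
    · rintro (z | z)
      · exact hlab z
      · cases z <;> simp [lab']
    · intro z k hk hz
      rw [Perm.sameCycle_comm, ← horb.mem_iff] at hz
      rcases z with z | z
      · obtain ⟨j, hj⟩ := exists_isOrb σ z
        have hzx : ¬ σ.SameCycle x z := fun h => hz <| by
          have := List.mem_map_of_mem (f := (Sum.inl : D → D ⊕ Bool)) (hx.mem_iff.2 h)
          rw [List.map_cons] at this
          rw [← List.cons_append]
          exact List.mem_append_left _ this
        have hj' := hj.inl.swap_mul (x := Sum.inl x) (y := Sum.inr true) (by
          rw [← List.map_cons, List.mem_map_of_injective Sum.inl_injective, hj.mem_iff]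
          exact fun h => hzx h.symm) (by simp)
        rw [hk.unique hj']
        have := hv z j hj fun h => hzx h.symm
        simpa [lab', Function.comp_def] using this
      · cases z
        · have hj' := (hb false).swap_mul (x := Sum.inl x) (y := Sum.inr true) (by simp) (by simp)
          rw [hk.unique hj']
          simpa [lab'] using hL w (by simp)
        · exact absurd (by simp) hz
    · rw [List.prod_cons, ← mul_assoc] at h1
      rw [← h1]
      simp [lab', Function.comp_def, mul_assoc]

theorem Symmetrized.inv_mem {R : Set (FreeGroup A)} (hR : Symmetrized R) {r : FreeGroup A}
    (hr : r ∈ R) : r⁻¹ ∈ R := by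
  classical
  have := (hR r.toWord isReduced_toWord (by rwa [mk_toWord])).2 (invRev r.toWord)
    (Or.inr (List.IsRotated.refl _))
  rwa [← inv_mk, mk_toWord] at this

theorem exists_list_of_mem_normalClosure {R : Set (FreeGroup A)} (hR : Symmetrized R)
    {w : FreeGroup A} (hw : w ∈ Subgroup.normalClosure R) :
    ∃ L : List (FreeGroup A), (∀ w ∈ L, TrivialOrConj R w⁻¹) ∧ w * L.prod = 1 := by
  have h1 : w⁻¹ ∈ (Subgroup.closure (Group.conjugatesOfSet R)).toSubmonoid :=
    Subgroup.inv_mem _ hw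
  rw [Subgroup.closure_toSubmonoid] at h1
  obtain ⟨L, hL, hp⟩ := Submonoid.exists_list_of_mem_closure h1
  refine ⟨L, fun y hy => ?_, by rw [hp, mul_inv_cancel]⟩
  rcases hL y hy with h | h
  · obtain ⟨r, hr, hc⟩ := Group.mem_conjugatesOfSet_iff.1 h
    obtain ⟨g, rfl⟩ := isConj_iff.1 hc
    exact Or.inr ⟨g, r⁻¹, hR.inv_mem hr, by group⟩
  · obtain ⟨r, hr, hc⟩ := Group.mem_conjugatesOfSet_iff.1 h
    obtain ⟨g, hg⟩ := isConj_iff.1 hc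
    exact Or.inr ⟨g, r, hr, hg.symm⟩

/-- In the group of an atorical presentation, commuting elements are powers of a common element:
they are the holonomies of a map on the torus whose vertices are labelled by relators. -/
theorem exists_zpow_of_commute {R : Set (FreeGroup A)} (hR : Symmetrized R) (hat : Atorical R)
    {N : Subgroup (FreeGroup A)} [N.Normal] (hN : N = Subgroup.normalClosure R)
    {x y : FreeGroup A} (hxy : Commute (x : FreeGroup A ⧸ N) (y : FreeGroup A ⧸ N)) :
    ∃ (c : FreeGroup A ⧸ N) (i j : ℤ), (x : FreeGroup A ⧸ N) = c ^ i ∧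
      (y : FreeGroup A ⧸ N) = c ^ j := by
  have hmem : x * y * x⁻¹ * y⁻¹ ∈ Subgroup.normalClosure R := by
    rw [← hN, ← QuotientGroup.eq_one_iff]
    change (x : FreeGroup A ⧸ N) * y * (x : FreeGroup A ⧸ N)⁻¹ * (y : FreeGroup A ⧸ N)⁻¹ = 1
    rw [hxy.eq]
    group
  obtain ⟨L, hL, hp⟩ := exists_list_of_mem_normalClosure hR hmem
  -- The torus with one vertex and two loops labelled `x` and `y`.
  let σ : Perm (Fin 4) := finRotate 4
  let τ : Perm (Fin 4) := swap 0 2 * swap 1 3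
  have hτ : ∀ d, τ (τ d) = d := by decide
  have hτ' : ∀ d, τ d ≠ d := by decide
  have ho : IsOrb σ 0 [1, 2, 3] := by
    constructor <;> decide
  have hσ : ∀ z, σ.SameCycle 0 z := fun z => ho.mem_iff.1 (by revert z; decide)
  have hg : genus2 σ τ ≤ 2 := by
    have h1 := card_eq_two_mul_classes hτ hτ'
    have h2 : classes (cyc σ) ≤ 1 := by
      have : Subsingleton (Quotient (cyc σ)) := ⟨fun a b => by
        induction a using Quotient.inductionOn with | _ a => ?_
        induction b using Quotient.inductionOn with | _ b => ?_
        exact Quotient.sound ((hσ a).symm.trans (hσ b))⟩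
      exact Finite.card_le_one_iff_subsingleton.2 this
    have h3 : classes (comps σ τ) ≤ classes (cyc σ) := classes_anti le_sup_left
    have h4 : 0 < classes (cyc σ) := Nat.card_pos_iff.2 ⟨⟨Quotient.mk _ 0⟩, inferInstance⟩
    have h5 : 0 < classes (cyc (σ * τ)) := Nat.card_pos_iff.2 ⟨⟨Quotient.mk _ 0⟩, inferInstance⟩
    rw [Nat.card_fin] at h1
    unfold genus2
    omega
  obtain ⟨c, p, hp1, hp2⟩ := gaugeCyclic_of_list hR hat (QuotientGroup.mk' N)
    (by rw [QuotientGroup.ker_mk', hN]) L hL (lab := ![x, y, x⁻¹, y⁻¹]) hτ hτ'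
    (by intro d; fin_cases d <;> simp [τ, swap_apply_def]) ho
    (fun z k _ hz => absurd (hσ z).symm hz) hg (by
      rw [← hp]; simp [mul_assoc])
  have e1 : p 3 = p 0 := hp1 0
  have e2 : p 2 = p 3 := hp1 3
  have e3 : p 1 = p 2 := hp1 2
  obtain ⟨i, hi⟩ := hp2 0
  obtain ⟨j, hj⟩ := hp2 1
  have hi' : c ^ i = p 0 * (x : FreeGroup A ⧸ N) * (p 1)⁻¹ := hi
  have hj' : c ^ j = p 1 * (y : FreeGroup A ⧸ N) * (p 2)⁻¹ := hj
  rw [e3, e2, e1] at hi' hj'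
  refine ⟨(p 0)⁻¹ * c * p 0, i, j, ?_, ?_⟩
  · have := conj_zpow (a := (p 0)⁻¹) (b := c) (i := i)
    rw [inv_inv] at this
    rw [this, hi']
    group
  · have := conj_zpow (a := (p 0)⁻¹) (b := c) (i := j)
    rw [inv_inv] at this
    rw [this, hj']
    group

end Commuting

/-! ### Reduction of conjugacy to double cosets of centralizers -/

section Conjugacy

theorem Atorical.mono {A : Type*} {R S : Set (FreeGroup A)} (hRS : R ⊆ S) (hS : Atorical S) :
    Atorical R :=
  fun D _ P hc ht ho => hS D P hc ht fun d => ⟨(ho d).1, hRS (ho d).2⟩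

variable {F : Type*} [Group F]

theorem conj_eq_conj_iff_commute {g a b x : F} :
    g * (a * x * a⁻¹) * g⁻¹ = b * x * b⁻¹ ↔ Commute (b⁻¹ * g * a) x := by
  have h1 : g * (a * x * a⁻¹) * g⁻¹ = b * ((b⁻¹ * g * a) * x * (b⁻¹ * g * a)⁻¹) * b⁻¹ := by group
  rw [h1, mul_left_inj, mul_right_inj, mul_inv_eq_iff_eq_mul]
  rfl

theorem quotient_inf_eq_iff {N₁ N₂ : Subgroup F} {a b : F} :
    (a : F ⧸ (N₁ ⊓ N₂)) = b ↔ (a : F ⧸ N₁) = b ∧ (a : F ⧸ N₂) = b := by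
  simp only [QuotientGroup.eq, Subgroup.mem_inf]

/-- Modulo `N₁` the two words become conjugates of `v'` by `ω ^ (-l)` and `1`; modulo `N₂` they are
both equal to `v'`. So conjugacy modulo `N₁ ⊓ N₂` is a condition on centralizers of `v'`. -/
theorem isConj_iff_exists_commute {N₁ N₂ : Subgroup F} [N₁.Normal] [N₂.Normal]
    {u v α β ω ν₁ ν₂ v' : F} {k l : ℤ} (hν₁ : ν₁ ∈ N₁) (hν₂ : ν₂ ∈ N₂)
    (hu : (u : F ⧸ (N₁ ⊓ N₂)) = (α * (ω ^ k * ν₁ * ω ^ (-l) * ν₂ * ω ^ l) * α⁻¹ : F))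
    (hv : (v : F ⧸ (N₁ ⊓ N₂)) = (β * (ω ^ k * ν₁ * ν₂) * β⁻¹ : F)) (hv' : v' = β⁻¹ * v * β) :
    IsConj (u : F ⧸ (N₁ ⊓ N₂)) (v : F ⧸ (N₁ ⊓ N₂)) ↔
      ∃ h : F, Commute ((h * (ω ^ l)⁻¹ : F) : F ⧸ N₁) v' ∧ Commute (h : F ⧸ N₂) v' := by
  obtain ⟨hu₁, hu₂⟩ := quotient_inf_eq_iff.1 hu
  obtain ⟨hv₁, hv₂⟩ := quotient_inf_eq_iff.1 hv
  have hn₁ : (ν₁ : F ⧸ N₁) = 1 := (QuotientGroup.eq_one_iff _).2 hν₁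
  have hn₂ : (ν₂ : F ⧸ N₂) = 1 := (QuotientGroup.eq_one_iff _).2 hν₂
  have hvv : v = β * v' * β⁻¹ := by rw [hv']; group
  have key : ∀ g : F, ((g * u * g⁻¹ : F) : F ⧸ (N₁ ⊓ N₂)) = v ↔
      Commute ((β⁻¹ * g * α * (ω ^ l)⁻¹ : F) : F ⧸ N₁) v' ∧
        Commute ((β⁻¹ * g * α : F) : F ⧸ N₂) v' := by
    intro g
    rw [quotient_inf_eq_iff]
    refine and_congr ?_ ?_
    · have e : (u : F ⧸ N₁) = (α * (ω ^ l)⁻¹ : F) * v' * ((α * (ω ^ l)⁻¹ : F) : F ⧸ N₁)⁻¹ := by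
        have e' : (v' : F ⧸ N₁) = ω ^ k * ν₂ := by
          rw [hv']
          simp only [QuotientGroup.mk_mul, QuotientGroup.mk_inv, QuotientGroup.mk_zpow,
            hn₁] at hv₁ ⊢
          rw [hv₁]; group
        simp only [QuotientGroup.mk_mul, QuotientGroup.mk_inv, QuotientGroup.mk_zpow, hn₁] at hu₁ ⊢
        rw [hu₁, e']
        group
      rw [hvv]
      simp only [QuotientGroup.mk_mul, QuotientGroup.mk_inv, QuotientGroup.mk_zpow] at e ⊢
      rw [e, conj_eq_conj_iff_commute]
      simp only [mul_assoc]
    · have e : (u : F ⧸ N₂) = α * v' * (α : F ⧸ N₂)⁻¹ := by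
        have e' : (v' : F ⧸ N₂) = ω ^ k * ν₁ := by
          rw [hv']
          simp only [QuotientGroup.mk_mul, QuotientGroup.mk_inv, QuotientGroup.mk_zpow,
            hn₂] at hv₂ ⊢
          rw [hv₂]; group
        simp only [QuotientGroup.mk_mul, QuotientGroup.mk_inv, QuotientGroup.mk_zpow, hn₂] at hu₂ ⊢
        rw [hu₂, e']
        group
      rw [hvv]
      simp only [QuotientGroup.mk_mul, QuotientGroup.mk_inv] at e ⊢
      rw [e, conj_eq_conj_iff_commute]
  rw [isConj_iff]
  constructor
  · rintro ⟨g, hg⟩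
    obtain ⟨g, rfl⟩ := QuotientGroup.mk_surjective g
    exact ⟨_, (key g).1 hg⟩
  · rintro ⟨h, hh⟩
    refine ⟨((β * h * α⁻¹ : F) : F ⧸ (N₁ ⊓ N₂)), (key _).2 ?_⟩
    have e : β⁻¹ * (β * h * α⁻¹) * α = h := by group
    rwa [e]

/-- Two powers of a common element, the first nontrivial: with `c` the common element or its
inverse, the second one is `c ^ s'` times a power of the first, `0 ≤ s' < s`. -/
theorem exists_isRootExponent {N : Subgroup F} [N.Normal] {v x : F} (hv : (v : F ⧸ N) ≠ 1)
    (h : ∃ (c : F ⧸ N) (i j : ℤ), (v : F ⧸ N) = c ^ i ∧ (x : F ⧸ N) = c ^ j) :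
    ∃ c : F, ∃ s s' q : ℤ, IsRootExponent N v c s ∧ 0 ≤ s' ∧ s' < s ∧
      (x : F ⧸ N) = (c : F ⧸ N) ^ s' * (v : F ⧸ N) ^ q := by
  classical
  have key : ∀ (c : F) (s j : ℤ), IsRootExponent N v c s → 0 < s → (x : F ⧸ N) = (c : F ⧸ N) ^ j →
      ∃ c : F, ∃ s s' q : ℤ, IsRootExponent N v c s ∧ 0 ≤ s' ∧ s' < s ∧
        (x : F ⧸ N) = (c : F ⧸ N) ^ s' * (v : F ⧸ N) ^ q := fun c s j hs h0 hx =>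
    ⟨c, s, j % s, j / s, hs, Int.emod_nonneg _ h0.ne', Int.emod_lt_of_pos _ h0, by
      rw [hs.1, ← zpow_mul, ← zpow_add, Int.emod_add_mul_ediv, hx]⟩
  obtain ⟨c, i, j, hi, hj⟩ := h
  obtain ⟨c, rfl⟩ := QuotientGroup.mk_surjective c
  have hex : ∃ n : ℕ, ∃ s : ℤ, s.natAbs = n ∧ (v : F ⧸ N) = (c : F ⧸ N) ^ s := ⟨_, i, rfl, hi⟩
  obtain ⟨s, hsn, hs⟩ := Nat.find_spec hex
  have hroot : IsRootExponent N v c s := ⟨hs, fun s' hs' => by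
    have := Nat.find_min' hex ⟨s', rfl, hs'⟩
    rw [← hsn] at this
    rw [Int.abs_eq_natAbs, Int.abs_eq_natAbs]
    exact_mod_cast this⟩
  rcases lt_trichotomy s 0 with h0 | h0 | h0
  · refine key c⁻¹ (-s) (-j) ⟨?_, fun s' hs' => ?_⟩ (by omega) ?_
    · rw [QuotientGroup.mk_inv, inv_zpow, zpow_neg, inv_inv, hs]
    · rw [abs_neg, ← abs_neg s']
      refine hroot.2 _ ?_
      rw [hs', QuotientGroup.mk_inv, inv_zpow, zpow_neg]
    · rw [QuotientGroup.mk_inv, inv_zpow, zpow_neg, inv_inv, hj]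
  · exact absurd (by rw [hs, h0, zpow_zero]) hv
  · exact key c s j hroot h0 hj

/-- An equality modulo `N` persists modulo a larger normal subgroup. -/
theorem quotient_eq_of_le {N M : Subgroup F} (h : N ≤ M) {a b : F} (hab : (a : F ⧸ N) = b) :
    (a : F ⧸ M) = b :=
  QuotientGroup.eq.2 (h (QuotientGroup.eq.1 hab))

theorem commute_of_mem_roots {N : Subgroup F} [N.Normal] {v c : F} (hc : c ∈ Roots N v) :
    Commute (c : F ⧸ N) v := by
  obtain ⟨s, hs⟩ := hc
  rw [hs]
  exact (Commute.refl _).zpow_right s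

/-- Chinese remainder theorem: `F ⧸ (N₁ ⊓ N₂)` is the fibre product of `F ⧸ N₁` and `F ⧸ N₂` over
`F ⧸ (N₁ ⊔ N₂)`. -/
theorem exists_common_lift {N₁ N₂ : Subgroup F} [N₁.Normal] [N₂.Normal] {a b : F}
    (h : (a : F ⧸ (N₁ ⊔ N₂)) = b) : ∃ x : F, (x : F ⧸ N₁) = a ∧ (x : F ⧸ N₂) = b := by
  obtain ⟨n₁, h₁, n₂, h₂, h12⟩ := Subgroup.mem_sup_of_normal_left.1 (QuotientGroup.eq.1 h)
  refine ⟨a * n₁, QuotientGroup.eq.2 ?_, QuotientGroup.eq.2 ?_⟩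
  · rw [mul_inv_rev, inv_mul_cancel_right]
    exact N₁.inv_mem h₁
  · rwa [mul_inv_rev, mul_assoc, ← h12, inv_mul_cancel_left]

end Conjugacy

end AtoricalConj

open AtoricalConj in
theorem lemma2 {A : Type*} [Finite A] (R₁ R₂ : Set (FreeGroup A))
    (hR₁ : R₁.Finite) (hR₂ : R₂.Finite) (hR₁' : R₁.Nonempty) (hR₂' : R₂.Nonempty)
    (hsymm₁ : Symmetrized R₁) (hsymm₂ : Symmetrized R₂)
    (N₁ N₂ : Subgroup (FreeGroup A)) [N₁.Normal] [N₂.Normal]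
    (hN₁ : N₁ = Subgroup.normalClosure R₁) (hN₂ : N₂ = Subgroup.normalClosure R₂)
    (hator : Atorical (R₁ ∪ R₂))
    (u v α β ω ν₁ ν₂ : FreeGroup A) (k l : ℤ) (hν₁ : ν₁ ∈ N₁) (hν₂ : ν₂ ∈ N₂)
    (hu : (u : FreeGroup A ⧸ (N₁ ⊓ N₂)) =
      (α * (ω ^ k * ν₁ * ω ^ (-l) * ν₂ * ω ^ l) * α⁻¹ : FreeGroup A))
    (hv : (v : FreeGroup A ⧸ (N₁ ⊓ N₂)) = (β * (ω ^ k * ν₁ * ν₂) * β⁻¹ : FreeGroup A))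
    (v' : FreeGroup A) (hv' : v' = β⁻¹ * v * β)
    (hne₁ : (v' : FreeGroup A ⧸ N₁) ≠ 1) (hne₂ : (v' : FreeGroup A ⧸ N₂) ≠ 1) :
    IsConj (u : FreeGroup A ⧸ (N₁ ⊓ N₂)) (v : FreeGroup A ⧸ (N₁ ⊓ N₂)) ↔
      ∃ c ∈ Roots N₁ v', ∃ d ∈ Roots N₂ v', ∃ s t : ℤ,
        IsRootExponent N₁ v' c s ∧ IsRootExponent N₂ v' d t ∧
        ∃ s' t' : ℤ, 0 ≤ s' ∧ s' < s ∧ 0 ≤ t' ∧ t' < t ∧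
          ((d ^ (-t') * c ^ (-s') * ω ^ l : FreeGroup A) : FreeGroup A ⧸ (N₁ ⊔ N₂)) ∈
            Subgroup.zpowers (v' : FreeGroup A ⧸ (N₁ ⊔ N₂)) := by
  rw [isConj_iff_exists_commute hν₁ hν₂ hu hv hv']
  constructor
  · -- `ω ^ l` is the product of an element commuting with `v'` modulo `N₁` and of one commuting
    -- with it modulo `N₂`; both are powers of a root of `v'`.
    rintro ⟨h, h₁, h₂⟩
    have h₁' : Commute (v' : FreeGroup A ⧸ N₁) ((h * (ω ^ l)⁻¹)⁻¹ : FreeGroup A) := by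
      rw [QuotientGroup.mk_inv]
      exact h₁.inv_left.symm
    obtain ⟨c, s, s', q, hc, hs0, hs, hx⟩ := exists_isRootExponent hne₁
      (exists_zpow_of_commute hsymm₁ (hator.mono Set.subset_union_left) hN₁ h₁')
    obtain ⟨d, t, t', r, hd, ht0, ht, hy⟩ := exists_isRootExponent hne₂
      (exists_zpow_of_commute hsymm₂ (hator.mono Set.subset_union_right) hN₂ h₂.symm)
    refine ⟨c, ⟨s, hc.1⟩, d, ⟨t, hd.1⟩, s, t, hc, hd, s', t', hs0, hs, ht0, ht, ?_⟩
    rw [← QuotientGroup.mk_zpow, ← QuotientGroup.mk_zpow, ← QuotientGroup.mk_mul] at hx hy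
    have hx' := quotient_eq_of_le (le_sup_left : N₁ ≤ N₁ ⊔ N₂) hx
    have hy' := quotient_eq_of_le (le_sup_right : N₂ ≤ N₁ ⊔ N₂) hy
    have hdc : Commute (d : FreeGroup A ⧸ (N₁ ⊔ N₂)) v' :=
      quotient_eq_of_le (le_sup_right : N₂ ≤ N₁ ⊔ N₂) (a := d * v') (b := v' * d)
        (commute_of_mem_roots ⟨t, hd.1⟩).eq
    have e : ω ^ l = (h * (ω ^ l)⁻¹)⁻¹ * h := by group
    rw [e]
    simp only [QuotientGroup.mk_mul, QuotientGroup.mk_zpow] at hx' hy' ⊢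
    rw [hx', hy', (hdc.zpow_zpow t' r).eq]
    refine ⟨q + r, ?_⟩
    have e' := (hdc.zpow_zpow (-t') (q + r)).eq
    calc (v' : FreeGroup A ⧸ (N₁ ⊔ N₂)) ^ (q + r)
        = (v' : FreeGroup A ⧸ (N₁ ⊔ N₂)) ^ (q + r) * (d : FreeGroup A ⧸ (N₁ ⊔ N₂)) ^ (-t') *
            (d : FreeGroup A ⧸ (N₁ ⊔ N₂)) ^ t' := by group
      _ = _ := by rw [← e']; group
  · -- Any roots and exponents will do here: `c` and `d` commute with `v'`.
    rintro ⟨c, hc, d, hd, s, t, -, -, s', t', -, -, -, -, m, hm⟩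
    have hm' : ((c ^ (-s') * ω ^ l : FreeGroup A) : FreeGroup A ⧸ (N₁ ⊔ N₂)) =
        (d ^ t' * v' ^ m : FreeGroup A) := by
      have hm : (v' : FreeGroup A ⧸ (N₁ ⊔ N₂)) ^ m = _ := hm
      simp only [QuotientGroup.mk_mul, QuotientGroup.mk_zpow] at hm ⊢
      rw [hm]
      group
    obtain ⟨h, h₁, h₂⟩ := exists_common_lift hm'
    refine ⟨h, ?_, ?_⟩
    · rw [QuotientGroup.mk_mul, h₁, ← QuotientGroup.mk_mul, mul_inv_cancel_right,
        QuotientGroup.mk_zpow]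
      exact (commute_of_mem_roots hc).zpow_left _
    · rw [h₂, QuotientGroup.mk_mul, QuotientGroup.mk_zpow, QuotientGroup.mk_zpow]
      exact ((commute_of_mem_roots hd).zpow_left _).mul_left ((Commute.refl _).zpow_left _)
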